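/- Write $H_2(p)=-p\log_2 p-(1-p)\log_2(1-p)$, and let $H_2^{-1}:[0,1]\to[0,\tfrac12]$ be the inverse of $H_2$ on $[0,\tfrac12]$. For $0\le\delta<\tfrac12$ put $$\kappa_{GV}(\delta)=1-H_2(\delta),\qquad \kappa_Z(\delta)=\sup_{0<\kappa<1-H_2(\delta)}\kappa\Bigl(1-\frac{\delta}{H_2^{-1}(1-\kappa)}\Bigr)$$ (the Gilbert–Varshamov and the Zyablov rate), and $\kappa_{GV}(\delta)=\kappa_Z(\delta)=0$ for $\delta\ge\tfrac12$. Distances are Hamming distances. Algorithms are randomized random access machines with logarithmic cost. There are absolute constants $A$ and $c$ such that for every $0<\epsilon\le1$ the following two statements hold. (1) There is a randomized algorithm that, given vectors $x_0,\dots,x_{n-1}\in\{0,1\}^m$ ($m\ge1$) among which a unique pair $\{x_i,x_j\}$, $i<j$, attains the minimum pairwise distance $d_{\min}$ (neither the pair nor $d_{\min}$ being known to the algorithm), always halts within time $$A\,\epsilon^{-1}\,n\log_2^2 n\cdot 2^{\left(1-\kappa_Z((1+\epsilon)\delta)-\delta H_2\left(\frac{1-\epsilon}{2}\right)\right)m}\,m^{c},\qquad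 \delta:=d_{\min}/m,$$ and with probability at least $1-1/n^2$ outputs $i$, $j$ and $d_{\min}$. (2) There is a randomized algorithm that does the same within time $$A\,\epsilon^{-1}\,n\log_2^2 n\cdot 2^{\left(1-\kappa_{GV}((1+\epsilon)\delta)-\delta H_2\left(\frac{1-\epsilon}{2}\right)\right)m}\,m^{c}$$ (so the exponent is $(H_2((1+\epsilon)\delta)-\delta H_2(\frac{1-\epsilon}{2}))m$ when $(1+\epsilon)\delta\le\frac12$), provided that it is given black-box access to unique decoders of an ensemble of $O(1+\epsilon^{-1}\log m)$ binary codes of length $m$ that meet the Gilbert–Varshamov bound: for each $k\ge0$ with $(1+\epsilon)^k\le m$, a code $C_k\subseteq\{0,1\}^m$ of minimum distance at least $d_k=2r_k+1$, $r_k=\lfloor(1+\epsilon)^k\rfloor$, with $|C_k|\ge2^{\kappa_{GV}(d_k/m)m}$, and a map that sends every word within distance $r_k$ of a codeword to that codeword. Moreover, every decoding radius between $d_{\min}/2$ and $d_{\min}$ works. Let $\{x_i,x_j\}$ be the unique closest pair of $x_0,\dots,x_{n-1}\in\{0,1\}^m$, let $C\subseteq\{0,1\}^m$ be a code of minimum distance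 at least $d$ with decoding radius $r=\lfloor\frac{d-1}{2}\rfloor$ satisfying $d_{\min}/2\le r\le d_{\min}$, and let $D:\{0,1\}^m\to\{0,1\}^m$ send every word within distance $r$ of a codeword to that codeword. Put $\mathrm{Dec}(v)=D(v)$ if $v$ and $D(v)$ have distance at most $r$, and $\mathrm{Dec}(v)=v$ otherwise. Then for at least $|C|\binom{d_{\min}}{r}$ of the shifts $y\in\{0,1\}^m$ one has $\mathrm{Dec}(y+x_i)=\mathrm{Dec}(y+x_j)\neq\mathrm{Dec}(y+x_k)$ for all $k\ne i,j$. -/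

import Mathlib

open MeasureTheory

/-! ## Entropy and the two rate functions -/

/-- The binary entropy function, in bits. -/
noncomputable def H2 (p : ℝ) : ℝ := Real.binEntropy p / Real.log 2

/-- The inverse of the binary entropy function on its increasing branch `[0, 1/2]`. -/
noncomputable def H2inv (y : ℝ) : ℝ := Function.invFunOn H2 (Set.Icc 0 (1 / 2)) y

/-- The Gilbert-Varshamov rate `1 - H2 δ` on `[0, 1/2]`, continued by `0` to the right. -/
noncomputable def kappaGV (δ : ℝ) : ℝ := if δ < 1 / 2 then 1 - H2 δ else 0

/-- The rate given by the Zyablov bound on `[0, 1/2]`, continued by `0` to the right. -/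
noncomputable def kappaZ (δ : ℝ) : ℝ :=
  if δ < 1 / 2 then
    sSup ((fun κ : ℝ => κ * (1 - δ / H2inv (1 - κ))) '' Set.Ioo 0 (1 - H2 δ))
  else 0

/-! ## Binary vectors, codes, unique decoding -/

/-- Binary vectors of length `m`. -/
abbrev BVec (m : ℕ) : Type := Fin m → ZMod 2

/-- `C` has minimum distance at least `d`. -/
def HasMinDist {m : ℕ} (C : Finset (BVec m)) (d : ℕ) : Prop :=
  ∀ v ∈ C, ∀ w ∈ C, v ≠ w → d ≤ hammingDist v w

/-- `D` decodes `C` up to radius `r`; nothing is asked of `D` on words that are farther than `r`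
from every codeword. -/
def Decodes {m : ℕ} (C : Finset (BVec m)) (r : ℕ) (D : BVec m → BVec m) : Prop :=
  ∀ v : BVec m, ∀ w ∈ C, hammingDist v w ≤ r → D v = w

/-- The decoding subroutine: run `D`, and keep its answer only if it is within distance `r`. -/
def dec {m : ℕ} (D : BVec m → BVec m) (r : ℕ) (v : BVec m) : BVec m :=
  if hammingDist v (D v) ≤ r then D v else v

/-- The pair `i < j` is the unique pair of indices with minimum pairwise distance. -/
def IsUniqueClosestPair {n m : ℕ} (x : Fin n → BVec m) (i j : Fin n) : Prop :=
  i < j ∧ ∀ k l : Fin n, k < l → (k, l) ≠ (i, j) →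
    hammingDist (x i) (x j) < hammingDist (x k) (x l)

/-- The shift `y` is good: after shifting by `y` and decoding, the vectors `i` and `j` coincide and
differ from all the others, so that they are adjacent in every sorting of the decoded list. -/
def IsGoodShift {n m : ℕ} (x : Fin n → BVec m) (i j : Fin n) (D : BVec m → BVec m) (r : ℕ)
    (y : BVec m) : Prop :=
  dec D r (y + x i) = dec D r (y + x j) ∧
    ∀ k : Fin n, k ≠ i → k ≠ j → dec D r (y + x k) ≠ dec D r (y + x i)

/-- The `k`-th decoding radius of the geometric search. -/
noncomputable def searchRadius (ε : ℝ) (k : ℕ) : ℕ := ⌊(1 + ε) ^ k⌋₊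

/-- An ensemble of codes of length `m` meeting the Gilbert-Varshamov bound, with decoders `D k`, one
for each of the (at most `1 + ε⁻¹ log₂ m`) indices `k` with `(1 + ε) ^ k ≤ m`. The `k`-th code has
decoding radius `searchRadius ε k`. The functions `D k` with `(1 + ε) ^ k > m` are arbitrary. -/
def IsGVEnsemble (ε : ℝ) (m : ℕ) (C : ℕ → Finset (BVec m)) (D : ℕ → BVec m → BVec m) : Prop :=
  ∀ k : ℕ, (1 + ε) ^ k ≤ (m : ℝ) →
    HasMinDist (C k) (2 * searchRadius ε k + 1) ∧
    (2 : ℝ) ^ (kappaGV (((2 * searchRadius ε k + 1 : ℕ) : ℝ) / m) * m) ≤ ((C k).card : ℝ) ∧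
    Decodes (C k) (searchRadius ε k) (D k)

/-! ## Randomized random access machines with logarithmic cost

A program has variables and a heap, both holding natural numbers, it can toss fair coins and it can
call decoders given as black boxes. -/

/-- Programs. The arguments named `v`, `a`, `b`, `k` are names of variables. -/
inductive Cmd : Type
  /-- do nothing -/
  | skip : Cmd
  /-- `v := c` for the literal `c` -/
  | const (v c : ℕ) : Cmd
  /-- `v := a + b` -/
  | add (v a b : ℕ) : Cmd
  /-- `v := a - b`, truncated at `0` -/
  | sub (v a b : ℕ) : Cmd
  /-- `v := heap[a]` -/
  | load (v a : ℕ) : Cmd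
  /-- `heap[a] := b` -/
  | store (a b : ℕ) : Cmd
  /-- `v :=` a random bit -/
  | flip (v : ℕ) : Cmd
  /-- apply the decoder number `k` to the word stored from address `a` on, and write the result
  from address `b` on -/
  | query (k a b : ℕ) : Cmd
  /-- sequential composition -/
  | seq (p q : Cmd) : Cmd
  /-- `if a < b then p else q` -/
  | ite (a b : ℕ) (p q : Cmd) : Cmd
  /-- `while a < b do p` -/
  | loop (a b : ℕ) (p : Cmd) : Cmd

/-- The program never calls a decoder. -/
def Cmd.QueryFree : Cmd → Prop
  | .query _ _ _ => False
  | .seq p q => p.QueryFree ∧ q.QueryFree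
  | .ite _ _ p q => p.QueryFree ∧ q.QueryFree
  | .loop _ _ p => p.QueryFree
  | _ => True

/-- Memory contents together with the coin tosses that have not been used yet. -/
structure RAMState where
  vars : ℕ → ℕ
  heap : ℕ → ℕ
  coins : ℕ → Bool

/-- Assign the value `c` to the variable `v`. -/
def RAMState.set (s : RAMState) (v c : ℕ) : RAMState :=
  { s with vars := Function.update s.vars v c }

/-- The word of length `m` stored in the heap from address `a` on. -/
def RAMState.readWord (s : RAMState) (m a : ℕ) : BVec m := fun k => (s.heap (a + k) : ZMod 2)

/-- Write a word into the heap from address `a` on. -/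
def RAMState.writeWord {m : ℕ} (s : RAMState) (a : ℕ) (w : BVec m) : RAMState :=
  { s with heap := fun p =>
      if h : a ≤ p ∧ p - a < m then (w ⟨p - a, h.2⟩).val else s.heap p }

/-- The logarithmic cost of handling a number: its bit length plus one. -/
def bitCost (a : ℕ) : ℕ := a.size + 1

/-- `Exec D p s s' t`: started in `s`, with `D` as the decoders for words of length `m`, the
program `p` halts in `s'` after time `t`. Every instruction is charged the bit lengths of all the
numbers and heap addresses that it handles. -/
inductive Exec {m : ℕ} (D : ℕ → BVec m → BVec m) : Cmd → RAMState → RAMState → ℕ → Prop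
  | skip (s : RAMState) : Exec D .skip s s 1
  | const (s : RAMState) (v c : ℕ) : Exec D (.const v c) s (s.set v c) (bitCost c)
  | add (s : RAMState) (v a b : ℕ) :
      Exec D (.add v a b) s (s.set v (s.vars a + s.vars b))
        (bitCost (s.vars a) + bitCost (s.vars b))
  | sub (s : RAMState) (v a b : ℕ) :
      Exec D (.sub v a b) s (s.set v (s.vars a - s.vars b))
        (bitCost (s.vars a) + bitCost (s.vars b))
  | load (s : RAMState) (v a : ℕ) :
      Exec D (.load v a) s (s.set v (s.heap (s.vars a)))
        (bitCost (s.vars a) + bitCost (s.heap (s.vars a)))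
  | store (s : RAMState) (a b : ℕ) :
      Exec D (.store a b) s { s with heap := Function.update s.heap (s.vars a) (s.vars b) }
        (bitCost (s.vars a) + bitCost (s.vars b))
  | flip (s : RAMState) (v : ℕ) :
      Exec D (.flip v) s
        { s.set v (s.coins 0).toNat with coins := fun k => s.coins (k + 1) } 1
  | query (s : RAMState) (k a b : ℕ) :
      Exec D (.query k a b) s
        (s.writeWord (s.vars b) (D (s.vars k) (s.readWord m (s.vars a))))
        (bitCost (s.vars k)
          + ∑ l : Fin m, (bitCost (s.vars a + l) + bitCost (s.heap (s.vars a + l))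
              + bitCost (s.vars b + l)) + 1)
  | seq {p q : Cmd} {s s' s'' : RAMState} {t t' : ℕ} :
      Exec D p s s' t → Exec D q s' s'' t' → Exec D (.seq p q) s s'' (t + t')
  | iteTrue {a b : ℕ} {p q : Cmd} {s s' : RAMState} {t : ℕ} :
      s.vars a < s.vars b → Exec D p s s' t →
      Exec D (.ite a b p q) s s' (bitCost (s.vars a) + bitCost (s.vars b) + t)
  | iteFalse {a b : ℕ} {p q : Cmd} {s s' : RAMState} {t : ℕ} :
      ¬ s.vars a < s.vars b → Exec D q s s' t →
      Exec D (.ite a b p q) s s' (bitCost (s.vars a) + bitCost (s.vars b) + t)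
  | loopTrue {a b : ℕ} {p : Cmd} {s s' s'' : RAMState} {t t' : ℕ} :
      s.vars a < s.vars b → Exec D p s s' t → Exec D (.loop a b p) s' s'' t' →
      Exec D (.loop a b p) s s'' (bitCost (s.vars a) + bitCost (s.vars b) + t + t')
  | loopFalse {a b : ℕ} {p : Cmd} {s : RAMState} :
      ¬ s.vars a < s.vars b →
      Exec D (.loop a b p) s s (bitCost (s.vars a) + bitCost (s.vars b))

/-- The initial state on input `x`: the variables `0` and `1` hold `n` and `m`, the heap cell
`i * m + k` holds the `k`-th bit of `x i`, everything else is `0`. -/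
def inputState {n m : ℕ} (x : Fin n → BVec m) (ω : ℕ → Bool) : RAMState where
  vars := fun v => if v = 0 then n else if v = 1 then m else 0
  heap := fun a =>
    if h : a < n * m then
      (x (finProdFinEquiv.symm ⟨a, h⟩).1 (finProdFinEquiv.symm ⟨a, h⟩).2).val
    else 0
  coins := ω

/-- The law of an infinite sequence of independent fair coin tosses. -/
noncomputable def coinLaw : Measure (ℕ → Bool) :=
  Measure.infinitePi fun _ : ℕ => (PMF.uniformOfFintype Bool).toMeasure

/-- On input `x`, the randomized program `p` with decoders `D` halts within time `T` for every
outcome of the coin tosses, and with probability at least `1 - 1 / n ^ 2` it halts with `i`, `j` and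
the distance of `x i` and `x j` in the variables `0`, `1` and `2`. -/
def Finds {n m : ℕ} (p : Cmd) (D : ℕ → BVec m → BVec m) (x : Fin n → BVec m) (i j : Fin n)
    (T : ℝ) : Prop :=
  (∀ ω : ℕ → Bool, ∃ (s : RAMState) (t : ℕ), Exec D p (inputState x ω) s t ∧ (t : ℝ) ≤ T) ∧
  1 - 1 / (n : ℝ) ^ 2 ≤ coinLaw.real {ω : ℕ → Bool | ∃ (s : RAMState) (t : ℕ),
    Exec D p (inputState x ω) s t ∧
      s.vars 0 = (i : ℕ) ∧ s.vars 1 = (j : ℕ) ∧ s.vars 2 = hammingDist (x i) (x j)}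

/-- The time bound `A ε⁻¹ n (log₂ n)² 2 ^ ((1 - κ((1 + ε) δ) - δ H2((1 - ε) / 2)) m) m ^ c`, where
`δ = d / m`, for a rate function `κ`. -/
noncomputable def timeBound (κ : ℝ → ℝ) (A : ℝ) (c : ℕ) (ε : ℝ) (n m d : ℕ) : ℝ :=
  A * ε⁻¹ * n * Real.logb 2 n ^ 2 *
    (2 : ℝ) ^ ((1 - κ ((1 + ε) * ((d : ℝ) / m)) - (d : ℝ) / m * H2 ((1 - ε) / 2)) * m) *
    (m : ℝ) ^ c

/-! # Closest pairs by searching in Hamming balls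

Words within half the minimum distance (rounded up) of the input vectors are generated breadth
first and kept in a table. A word half-way between the two closest vectors is reached from both of
them, so the closest pair shows up as a collision; the search is abandoned for a comparison of all
pairs once the balls turn out to be larger than `n` words each. The time is therefore about
`n * min n V`, where `V` is the size of a ball. For `δ ≤ 1 / 4` the inequality
`H2 (δ / 2) + δ ≤ H2 δ` bounds `V`, and for larger `δ` the sphere packing and Singleton bounds
control `n`, in both cases by `2 ^ ((1 - κGV δ - δ) m)` up to a polynomial factor. -/

/-! ## Words between two words -/

section HammingSpace

variable {ι : Type*} [Fintype ι] {β : ι → Type*} [∀ i, DecidableEq (β i)]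

theorem hammingDist_add_left [∀ i, AddGroup (β i)] (u v w : ∀ i, β i) :
    hammingDist (u + v) (u + w) = hammingDist v w :=
  hammingDist_comp (fun i a => u i + a) fun _ => add_right_injective _

theorem hammingDist_sub_add_self [∀ i, AddGroup (β i)] (c u v : ∀ i, β i) :
    hammingDist (c - u + v) c = hammingDist u v := by
  nth_rw 2 [← sub_add_cancel c u]
  rw [hammingDist_add_left, hammingDist_comm]

variable [DecidableEq ι]

/-- The words on the shortest paths from `v` to `w` that are `r` steps away from `v`. -/
def betweenWords (v w : ∀ i, β i) (r : ℕ) : Finset (∀ i, β i) :=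
  (Finset.powersetCard r {i | v i ≠ w i}).image fun S => S.piecewise w v

theorem piecewise_ne_left_iff {v w : ∀ i, β i} {S : Finset ι}
    (hS : S ⊆ ({i | v i ≠ w i} : Finset ι)) (i : ι) : S.piecewise w v i ≠ v i ↔ i ∈ S := by
  by_cases hi : i ∈ S
  · simpa [hi, eq_comm] using hS hi
  · simp [hi]

theorem injOn_piecewise (v w : ∀ i, β i) (r : ℕ) :
    Set.InjOn (fun S : Finset ι => S.piecewise w v)
      (Finset.powersetCard r {i | v i ≠ w i} : Finset (Finset ι)) := by
  intro S hS T hT hST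
  ext i
  rw [← piecewise_ne_left_iff (Finset.mem_powersetCard.1 hS).1,
    ← piecewise_ne_left_iff (Finset.mem_powersetCard.1 hT).1]
  exact not_congr (by rw [show S.piecewise w v = T.piecewise w v from hST])

theorem card_betweenWords (v w : ∀ i, β i) (r : ℕ) :
    (betweenWords v w r).card = (hammingDist v w).choose r := by
  rw [betweenWords, Finset.card_image_of_injOn (injOn_piecewise v w r), Finset.card_powersetCard]
  rfl

theorem hammingDist_left_of_mem_betweenWords {u v w : ∀ i, β i} {r : ℕ}
    (hu : u ∈ betweenWords v w r) : hammingDist u v = r := by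
  obtain ⟨S, hS, rfl⟩ := Finset.mem_image.1 hu
  obtain ⟨hSvw, rfl⟩ := Finset.mem_powersetCard.1 hS
  exact congrArg Finset.card (by ext i; simpa using piecewise_ne_left_iff hSvw i)

theorem le_hammingDist_of_mem_betweenWords {u v w : ∀ i, β i} {r : ℕ}
    (hu : u ∈ betweenWords v w r) : r ≤ hammingDist v w := by
  obtain ⟨S, hS, rfl⟩ := Finset.mem_image.1 hu
  obtain ⟨hSvw, rfl⟩ := Finset.mem_powersetCard.1 hS
  exact Finset.card_le_card hSvw

theorem hammingDist_right_of_mem_betweenWords {u v w : ∀ i, β i} {r : ℕ}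
    (hu : u ∈ betweenWords v w r) : hammingDist u w = hammingDist v w - r := by
  obtain ⟨S, hS, rfl⟩ := Finset.mem_image.1 hu
  obtain ⟨hSvw, rfl⟩ := Finset.mem_powersetCard.1 hS
  have hdiff : ({i | S.piecewise w v i ≠ w i} : Finset ι) =
      ({i | v i ≠ w i} : Finset ι) \ S := by
    ext i
    by_cases hi : i ∈ S <;> simp [hi]
  exact (congrArg Finset.card hdiff).trans (Finset.card_sdiff_of_subset hSvw)

theorem betweenWords_nonempty {v w : ∀ i, β i} {r : ℕ} (hr : r ≤ hammingDist v w) :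
    (betweenWords v w r).Nonempty := by
  rw [← Finset.card_pos, card_betweenWords]
  exact Nat.choose_pos hr

theorem sphere_packing_bound [∀ i, Fintype (β i)] [∀ i, Nontrivial (β i)]
    {κ : Type*} [Fintype κ] {x : κ → ∀ i, β i} {e : ℕ}
    (hx : Pairwise fun k l => 2 * e < hammingDist (x k) (x l)) :
    Fintype.card κ * (Fintype.card ι).choose e ≤ Fintype.card (∀ i, β i) := by
  choose f hf using fun i (a : β i) => exists_ne a
  have hfar (v : ∀ i, β i) : hammingDist v (fun i => f i (v i)) = Fintype.card ι := by
    simp [hammingDist, (hf _ _).symm]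
  let sphere (k : κ) := betweenWords (x k) (fun i => f i (x k i)) e
  have hdisj : (Set.univ : Set κ).PairwiseDisjoint sphere := by
    intro k _ l _ hkl
    refine Finset.disjoint_left.2 fun u huk hul => ?_
    have htri := hammingDist_triangle_left (x k) (x l) u
    rw [hammingDist_left_of_mem_betweenWords huk, hammingDist_left_of_mem_betweenWords hul] at htri
    have := hx hkl
    omega
  calc Fintype.card κ * (Fintype.card ι).choose e = ∑ k, (sphere k).card := by
        simp [sphere, card_betweenWords, hfar]
    _ = (Finset.univ.biUnion sphere).card := (Finset.card_biUnion (by simpa using hdisj)).symm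
    _ ≤ Fintype.card (∀ i, β i) := Finset.card_le_univ _

end HammingSpace

theorem singleton_bound {ι κ α : Type*} [Fintype ι] [Fintype κ] [Fintype α]
    [DecidableEq α] {x : κ → ι → α} {d : ℕ} (hd : 1 ≤ d)
    (hx : Pairwise fun k l => d ≤ hammingDist (x k) (x l)) :
    Fintype.card κ ≤ Fintype.card α ^ (Fintype.card ι + 1 - d) := by
  classical
  obtain ⟨T, -, hT⟩ := Finset.exists_subset_card_eq (s := (Finset.univ : Finset ι))
    (n := Fintype.card ι + 1 - d) (by rw [Finset.card_univ]; omega)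
  have hinj : Function.Injective fun k (t : T) => x k t := by
    intro k l hkl
    by_contra hne
    have hdist : hammingDist (x k) (x l) ≤ Tᶜ.card :=
      Finset.card_le_card fun i hi =>
        Finset.mem_compl.2 fun hiT => (Finset.mem_filter.1 hi).2 (congrFun hkl ⟨i, hiT⟩)
    have := hx hne
    rw [Finset.card_compl, hT] at hdist
    omega
  simpa [hT] using Fintype.card_le_of_injective _ hinj

namespace IsUniqueClosestPair

variable {n m : ℕ} {x : Fin n → BVec m} {i j k l : Fin n}

theorem eq_of_hammingDist_le (h : IsUniqueClosestPair x i j) (hkl : k ≠ l)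
    (hle : hammingDist (x k) (x l) ≤ hammingDist (x i) (x j)) :
    (k = i ∧ l = j) ∨ (k = j ∧ l = i) := by
  rcases hkl.lt_or_gt with hlt | hlt
  · by_contra hne
    exact (h.2 k l hlt (by grind)).not_ge hle
  · by_contra hne
    rw [hammingDist_comm] at hle
    exact (h.2 l k hlt (by grind)).not_ge hle

theorem hammingDist_le (h : IsUniqueClosestPair x i j) (hkl : k ≠ l) :
    hammingDist (x i) (x j) ≤ hammingDist (x k) (x l) := by
  by_contra! hlt
  rcases h.eq_of_hammingDist_le hkl hlt.le with ⟨rfl, rfl⟩ | ⟨rfl, rfl⟩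
  · exact lt_irrefl _ hlt
  · exact hlt.ne (hammingDist_comm _ _)

end IsUniqueClosestPair

/-! ## Good shifts -/

section GoodShifts

variable {m r : ℕ} {C : Finset (BVec m)} {D : BVec m → BVec m} {c v : BVec m}

theorem Decodes.dec_eq (hD : Decodes C r D) (hc : c ∈ C) (hv : hammingDist v c ≤ r) :
    dec D r v = c := by
  simp only [dec, hD v c hc hv, if_pos hv]

theorem hammingDist_le_of_dec_eq (h : dec D r v = c) : hammingDist v c ≤ r := by
  unfold dec at h
  split_ifs at h with hv
  · rwa [h] at hv
  · simp [h]

variable {n : ℕ} {x : Fin n → BVec m} {i j : Fin n} {u : BVec m}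

theorem IsUniqueClosestPair.isGoodShift_sub (hx : IsUniqueClosestPair x i j) (hD : Decodes C r D)
    (hle : hammingDist (x i) (x j) ≤ 2 * r) (hc : c ∈ C) (hu : u ∈ betweenWords (x i) (x j) r) :
    IsGoodShift x i j D r (c - u) := by
  have hui : hammingDist u (x i) = r := hammingDist_left_of_mem_betweenWords hu
  have huj : hammingDist u (x j) = hammingDist (x i) (x j) - r :=
    hammingDist_right_of_mem_betweenWords hu
  have hdec {k : Fin n} (hk : hammingDist u (x k) ≤ r) : dec D r (c - u + x k) = c :=
    hD.dec_eq hc (by rwa [hammingDist_sub_add_self])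
  have hi : dec D r (c - u + x i) = c := hdec hui.le
  refine ⟨hi.trans (hdec (by omega)).symm, fun k hki hkj hk => ?_⟩
  have huk : hammingDist u (x k) ≤ r := by
    simpa only [hammingDist_sub_add_self] using hammingDist_le_of_dec_eq (hk.trans hi)
  have hkj_le : hammingDist (x k) (x j) ≤ hammingDist (x i) (x j) := by
    have := hammingDist_triangle_left (x k) (x j) u
    have := le_hammingDist_of_mem_betweenWords hu
    omega
  rcases hx.eq_of_hammingDist_le hkj hkj_le with h | h
  · exact hki h.1
  · exact hkj h.1

theorem IsUniqueClosestPair.card_mul_choose_le_ncard_isGoodShift (hx : IsUniqueClosestPair x i j)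
    (hD : Decodes C r D) (hle : hammingDist (x i) (x j) ≤ 2 * r) :
    C.card * (hammingDist (x i) (x j)).choose r ≤ {y | IsGoodShift x i j D r y}.ncard := by
  have hinj : Set.InjOn (fun p : BVec m × BVec m => p.1 - p.2)
      (C ×ˢ betweenWords (x i) (x j) r : Finset (BVec m × BVec m)) := by
    rintro ⟨c, u⟩ hcu ⟨c', u'⟩ hcu' (heq : c - u = c' - u')
    obtain ⟨hc : c ∈ C, hu : u ∈ _⟩ := Finset.mem_product.1 hcu
    obtain ⟨hc' : c' ∈ C, hu' : u' ∈ _⟩ := Finset.mem_product.1 hcu'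
    have hdec {c u : BVec m} (hc : c ∈ C) (hu : u ∈ betweenWords (x i) (x j) r) :
        D (c - u + x i) = c :=
      hD _ c hc (by rw [hammingDist_sub_add_self, hammingDist_left_of_mem_betweenWords hu])
    have hcc : c = c' := by rw [← hdec hc hu, ← hdec hc' hu', heq]
    subst hcc
    exact Prod.ext rfl (sub_right_injective heq)
  rw [← card_betweenWords, ← Finset.card_product, ← Finset.card_image_of_injOn hinj,
    ← Set.ncard_coe_finset]
  refine Set.ncard_le_ncard (fun y hy => ?_) (Set.toFinite _)
  obtain ⟨⟨c, u⟩, hcu, rfl⟩ := Finset.mem_image.1 (Finset.mem_coe.1 hy)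
  obtain ⟨hc, hu⟩ := Finset.mem_product.1 hcu
  exact hx.isGoodShift_sub hD hle hc hu

end GoodShifts

/-! ## Entropy and binomial coefficients -/

theorem H2_nonneg {p : ℝ} (h0 : 0 ≤ p) (h1 : p ≤ 1) : 0 ≤ H2 p :=
  div_nonneg (Real.binEntropy_nonneg h0 h1) (Real.log_nonneg one_le_two)

theorem H2_le_one (p : ℝ) : H2 p ≤ 1 :=
  div_le_one_of_le₀ Real.binEntropy_le_log_two (Real.log_nonneg one_le_two)

theorem H2_zero : H2 0 = 0 := by
  simp [H2]

theorem H2_half : H2 (1 / 2) = 1 := by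
  rw [H2, one_div, Real.binEntropy_two_inv, div_self (Real.log_pos one_lt_two).ne']

theorem continuous_H2 : Continuous H2 :=
  Real.binEntropy_continuous.div_const _

theorem monotoneOn_H2 : MonotoneOn H2 (Set.Icc 0 (1 / 2)) := by
  intro p hp q hq hpq
  rw [one_div] at hp hq
  exact div_le_div_of_nonneg_right (Real.binEntropy_strictMonoOn.monotoneOn hp hq hpq)
    (Real.log_nonneg one_le_two)

theorem concaveOn_H2 : ConcaveOn ℝ (Set.Icc 0 1) H2 := by
  have hsmul : H2 = (Real.log 2)⁻¹ • Real.binEntropy := by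
    ext p
    rw [Pi.smul_apply, smul_eq_mul, H2, div_eq_inv_mul]
  rw [hsmul]
  exact Real.strictConcave_binEntropy.concaveOn.smul (inv_nonneg.2 (Real.log_nonneg one_le_two))

theorem H2_div_add_mul_log_two (k l : ℕ) :
    H2 ((k : ℝ) / (k + l)) * (k + l) * Real.log 2 =
      (k + l) * Real.log (k + l) - k * Real.log k - l * Real.log l := by
  rcases eq_or_ne ((k : ℝ) + l) 0 with h0 | h0
  · obtain ⟨hk, hl⟩ := (add_eq_zero_iff_of_nonneg k.cast_nonneg l.cast_nonneg).1 h0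
    simp [hk, hl]
  have hterm (a : ℕ) : a / (k + l) * Real.log ((a : ℝ) / (k + l))⁻¹ * (k + l) =
      a * Real.log (k + l) - a * Real.log a := by
    rcases eq_or_ne (a : ℝ) 0 with ha | ha
    · simp [ha]
    · rw [inv_div, Real.log_div h0 ha]
      field_simp
  have hl : 1 - (k : ℝ) / (k + l) = l / (k + l) := by
    field_simp
    ring
  have hlog : Real.log 2 ≠ 0 := (Real.log_pos one_lt_two).ne'
  calc H2 ((k : ℝ) / (k + l)) * (k + l) * Real.log 2
      = k / (k + l) * Real.log ((k : ℝ) / (k + l))⁻¹ * (k + l) +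
          l / (k + l) * Real.log ((l : ℝ) / (k + l))⁻¹ * (k + l) := by
        rw [H2, Real.binEntropy, hl]
        field_simp
    _ = _ := by
        rw [hterm k, hterm l]
        ring

theorem natCast_pow_self_pos (a : ℕ) : (0 : ℝ) < (a : ℝ) ^ a := by
  exact_mod_cast Nat.pow_self_pos

theorem two_rpow_H2_mul_pow_mul_pow (k l : ℕ) :
    (2 : ℝ) ^ (H2 ((k : ℝ) / (k + l)) * (k + l)) * ((k : ℝ) ^ k * (l : ℝ) ^ l) =
      ((k : ℝ) + l) ^ (k + l) := by
  have hkl : (0 : ℝ) < k ^ k * l ^ l := mul_pos (natCast_pow_self_pos k) (natCast_pow_self_pos l)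
  have hsum : (0 : ℝ) < ((k : ℝ) + l) ^ (k + l) := by exact_mod_cast natCast_pow_self_pos (k + l)
  have h2 : (0 : ℝ) < (2 : ℝ) ^ (H2 ((k : ℝ) / (k + l)) * (k + l)) := by positivity
  refine Real.log_injOn_pos (mul_pos h2 hkl) hsum ?_
  rw [Real.log_mul h2.ne' hkl.ne', Real.log_rpow two_pos, H2_div_add_mul_log_two,
    Real.log_mul (natCast_pow_self_pos k).ne' (natCast_pow_self_pos l).ne', Real.log_pow,
    Real.log_pow, Real.log_pow]
  push_cast
  ring

theorem choose_le_two_rpow_H2 (k l : ℕ) :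
    ((k + l).choose k : ℝ) ≤ (2 : ℝ) ^ (H2 ((k : ℝ) / (k + l)) * (k + l)) := by
  have hterm : (k : ℝ) ^ k * (l : ℝ) ^ l * (k + l).choose k ≤ ((k : ℝ) + l) ^ (k + l) := by
    rw [add_pow]
    simpa using Finset.single_le_sum
      (f := fun t => (k : ℝ) ^ t * (l : ℝ) ^ (k + l - t) * (k + l).choose t)
      (fun t _ => by positivity) (Finset.mem_range.2 (by omega : k < k + l + 1))
  rw [← two_rpow_H2_mul_pow_mul_pow, mul_comm] at hterm
  exact le_of_mul_le_mul_right hterm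
    (mul_pos (natCast_pow_self_pos k) (natCast_pow_self_pos l))

theorem factorial_mul_pow_le (a t : ℕ) : a.factorial * a ^ t ≤ t.factorial * a ^ a := by
  rcases le_total a t with h | h
  · calc a.factorial * a ^ t = a.factorial * a ^ (t - a) * a ^ a := by
          rw [mul_assoc, ← pow_add, Nat.sub_add_cancel h]
      _ ≤ t.factorial * a ^ a := by
          gcongr
          exact Nat.factorial_mul_pow_sub_le_factorial h
  · calc a.factorial * a ^ t = t.factorial * a.descFactorial (a - t) * a ^ t := by
          rw [← Nat.factorial_mul_descFactorial (Nat.sub_le a t), Nat.sub_sub_self h]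
      _ ≤ t.factorial * a ^ (a - t) * a ^ t := by
          gcongr
          exact Nat.descFactorial_le_pow a (a - t)
      _ = t.factorial * a ^ a := by rw [mul_assoc, ← pow_add, Nat.sub_add_cancel h]

theorem binomial_term_le (k l : ℕ) {t : ℕ} (ht : t ≤ k + l) :
    k ^ t * l ^ (k + l - t) * (k + l).choose t ≤ k ^ k * l ^ l * (k + l).choose k := by
  have hfac : 0 < t.factorial * (k + l - t).factorial * (k.factorial * l.factorial) := by
    positivity
  refine Nat.le_of_mul_le_mul_right ?_ hfac
  calc k ^ t * l ^ (k + l - t) * (k + l).choose t *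
        (t.factorial * (k + l - t).factorial * (k.factorial * l.factorial))
      = (k.factorial * k ^ t) * (l.factorial * l ^ (k + l - t)) *
          ((k + l).choose t * t.factorial * (k + l - t).factorial) := by ring
    _ = (k.factorial * k ^ t) * (l.factorial * l ^ (k + l - t)) *
          ((k + l).choose k * k.factorial * l.factorial) := by
        rw [Nat.choose_mul_factorial_mul_factorial ht, Nat.choose_symm_add,
          Nat.add_choose_mul_factorial_mul_factorial]
    _ ≤ (t.factorial * k ^ k) * ((k + l - t).factorial * l ^ l) *
          ((k + l).choose k * k.factorial * l.factorial) := by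
        gcongr ?_ * ?_ * _
        · exact factorial_mul_pow_le k t
        · exact factorial_mul_pow_le l (k + l - t)
    _ = _ := by ring

theorem two_rpow_H2_le_choose (k l : ℕ) :
    (2 : ℝ) ^ (H2 ((k : ℝ) / (k + l)) * (k + l)) ≤ (k + l + 1) * (k + l).choose k := by
  have hsum : (k + l) ^ (k + l) ≤ (k + l + 1) * (k ^ k * l ^ l * (k + l).choose k) := by
    rw [add_pow]
    simpa using Finset.sum_le_card_nsmul (Finset.range (k + l + 1)) _ _ fun t ht =>
      binomial_term_le k l (Nat.lt_succ_iff.1 (Finset.mem_range.1 ht))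
  have hsum' : ((k : ℝ) + l) ^ (k + l) ≤ (k + l + 1) * (k ^ k * l ^ l * (k + l).choose k) := by
    exact_mod_cast hsum
  rw [← two_rpow_H2_mul_pow_mul_pow] at hsum'
  refine le_of_mul_le_mul_right (hsum'.trans_eq (by ring))
    (mul_pos (natCast_pow_self_pos k) (natCast_pow_self_pos l))

theorem choose_succ_le_mul_choose (m k : ℕ) : m.choose (k + 1) ≤ m * m.choose k := by
  calc m.choose (k + 1) ≤ m.choose (k + 1) * (k + 1) := Nat.le_mul_of_pos_right _ k.succ_pos
    _ = m.choose k * (m - k) := Nat.choose_succ_right_eq m k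
    _ ≤ m.choose k * m := Nat.mul_le_mul_left _ (Nat.sub_le m k)
    _ = m * m.choose k := mul_comm _ _

/-! ## Numerical comparison of exponents -/

theorem H2_quarter_mul_log_two :
    H2 (1 / 4) * Real.log 2 = 2 * Real.log 2 - 3 / 4 * Real.log 3 := by
  have h4 : Real.log 4 = 2 * Real.log 2 := by
    rw [show (4 : ℝ) = 2 ^ 2 by norm_num, Real.log_pow, Nat.cast_ofNat]
  have h := H2_div_add_mul_log_two 1 3
  norm_num [h4] at h ⊢
  linarith

theorem H2_eighth_mul_log_two :
    H2 (1 / 8) * Real.log 2 = 3 * Real.log 2 - 7 / 8 * Real.log 7 := by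
  have h8 : Real.log 8 = 3 * Real.log 2 := by
    rw [show (8 : ℝ) = 2 ^ 3 by norm_num, Real.log_pow, Nat.cast_ofNat]
  have h := H2_div_add_mul_log_two 1 7
  norm_num [h8] at h ⊢
  linarith

theorem H2_eighth_add_quarter_le : H2 (1 / 8) + 1 / 4 ≤ H2 (1 / 4) := by
  have hlog : 6 * Real.log 3 + 10 * Real.log 2 ≤ 7 * Real.log 7 := by
    have := Real.log_le_log (x := 3 ^ 6 * 2 ^ 10) (y := 7 ^ 7) (by norm_num) (by norm_num)
    rw [Real.log_mul (by norm_num) (by norm_num)] at this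
    simpa only [Real.log_pow, Nat.cast_ofNat] using this
  refine le_of_mul_le_mul_right ?_ (Real.log_pos one_lt_two)
  rw [add_mul, H2_quarter_mul_log_two, H2_eighth_mul_log_two]
  linarith

theorem one_add_quarter_le_H2_quarter_add : 1 + 1 / 4 ≤ H2 (1 / 4) + H2 (1 / 8) := by
  have hlog : 6 * Real.log 3 + 7 * Real.log 7 ≤ 30 * Real.log 2 := by
    have := Real.log_le_log (x := 3 ^ 6 * 7 ^ 7) (y := 2 ^ 30) (by norm_num) (by norm_num)
    rw [Real.log_mul (by norm_num) (by norm_num)] at this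
    simpa only [Real.log_pow, Nat.cast_ofNat] using this
  refine le_of_mul_le_mul_right ?_ (Real.log_pos one_lt_two)
  rw [add_mul (H2 (1 / 4)), H2_quarter_mul_log_two, H2_eighth_mul_log_two]
  linarith

theorem half_le_H2_quarter : 1 / 2 ≤ H2 (1 / 4) := by
  have hlog : Real.log 3 ≤ 2 * Real.log 2 := by
    have := Real.log_le_log (x := 3) (y := 2 ^ 2) (by norm_num) (by norm_num)
    simpa only [Real.log_pow, Nat.cast_ofNat] using this
  refine le_of_mul_le_mul_right ?_ (Real.log_pos one_lt_two)
  rw [H2_quarter_mul_log_two]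
  linarith

theorem H2_half_add_le {δ : ℝ} (h0 : 0 ≤ δ) (h1 : δ ≤ 1 / 4) : H2 (δ / 2) + δ ≤ H2 δ := by
  rcases h0.eq_or_lt with rfl | hpos
  · simp
  have hslope : 2 ≤ slope H2 (δ / 2) δ := calc
    2 ≤ slope H2 (1 / 4) (1 / 8) := by
        rw [slope_comm, slope_def_field, le_div_iff₀ (by norm_num)]
        linarith [H2_eighth_add_quarter_le]
    _ ≤ slope H2 (1 / 4) (δ / 2) :=
        concaveOn_H2.slope_anti (by norm_num)
          ⟨⟨by linarith, by linarith⟩, fun h => by linarith [Set.mem_singleton_iff.1 h]⟩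
          (by norm_num) (by linarith)
    _ = slope H2 (δ / 2) (1 / 4) := slope_comm _ _ _
    _ ≤ slope H2 (δ / 2) δ :=
        concaveOn_H2.slope_anti ⟨by linarith, by linarith⟩
          ⟨⟨by linarith, by linarith⟩, fun h => by linarith [Set.mem_singleton_iff.1 h]⟩
          ⟨⟨by norm_num, by norm_num⟩, fun h => by linarith [Set.mem_singleton_iff.1 h]⟩ h1
  rw [slope_def_field, le_div_iff₀ (by linarith)] at hslope
  linarith

theorem one_add_le_H2_add_H2_half {δ : ℝ} (h0 : 1 / 4 ≤ δ) (h1 : δ ≤ 1 / 2) :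
    1 + δ ≤ H2 δ + H2 (δ / 2) := by
  have hconcave {p q : ℝ} (hp : p ∈ Set.Icc (0 : ℝ) 1) (hq : q ∈ Set.Icc (0 : ℝ) 1) :
      (2 - 4 * δ) * H2 p + (4 * δ - 1) * H2 q ≤ H2 ((2 - 4 * δ) * p + (4 * δ - 1) * q) :=
    concaveOn_H2.2 hp hq (by linarith) (by linarith) (by ring)
  have hδ := hconcave (p := 1 / 4) (q := 1 / 2) (by norm_num) (by norm_num)
  have hδ_half := hconcave (p := 1 / 8) (q := 1 / 4) (by norm_num) (by norm_num)
  rw [show (2 - 4 * δ) * (1 / 4) + (4 * δ - 1) * (1 / 2) = δ by ring, H2_half] at hδ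
  rw [show (2 - 4 * δ) * (1 / 8) + (4 * δ - 1) * (1 / 4) = δ / 2 by ring] at hδ_half
  have hleft := mul_le_mul_of_nonneg_left one_add_quarter_le_H2_quarter_add
    (show 0 ≤ 2 - 4 * δ by linarith)
  have hright := mul_le_mul_of_nonneg_left half_le_H2_quarter (show 0 ≤ 4 * δ - 1 by linarith)
  linarith

/-! ## The two rates -/

theorem antitoneOn_kappaGV : AntitoneOn kappaGV (Set.Ici 0) := by
  intro s hs t ht hst
  rw [Set.mem_Ici] at hs ht
  unfold kappaGV
  split_ifs with htlt hslt
  · exact sub_le_sub_left (monotoneOn_H2 ⟨hs, hslt.le⟩ ⟨ht, htlt.le⟩ hst) 1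
  · linarith
  · linarith [H2_le_one s]
  · exact le_rfl

theorem H2inv_nonneg {y : ℝ} (h0 : 0 ≤ y) (h1 : y ≤ 1) : 0 ≤ H2inv y := by
  have hy : ∃ p ∈ Set.Icc (0 : ℝ) (1 / 2), H2 p = y :=
    intermediate_value_Icc (by norm_num) continuous_H2.continuousOn
      (by rw [H2_zero, H2_half]; exact ⟨h0, h1⟩)
  exact (Function.invFunOn_mem hy).1

theorem kappaZ_le_kappaGV {δ : ℝ} (h0 : 0 ≤ δ) : kappaZ δ ≤ kappaGV δ := by
  unfold kappaZ kappaGV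
  split_ifs with hδ
  · refine Real.sSup_le ?_ (sub_nonneg.2 (H2_le_one δ))
    rintro _ ⟨κ, ⟨hκ0, hκ1⟩, rfl⟩
    have hH2 := H2_nonneg h0 (by linarith)
    have hinv : 0 ≤ δ / H2inv (1 - κ) :=
      div_nonneg h0 (H2inv_nonneg (by linarith) (by linarith))
    exact (mul_le_of_le_one_right hκ0.le (by linarith)).trans hκ1.le
  · exact le_rfl

theorem logb_two_natCast_le_sq (n : ℕ) : Real.logb 2 n ≤ Real.logb 2 n ^ 2 := by
  rcases lt_or_ge n 2 with hn | hn
  · interval_cases n <;> simp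
  · have hlog : 1 ≤ Real.logb 2 n := by
      rw [Real.le_logb_iff_rpow_le one_lt_two (by positivity), Real.rpow_one]
      exact_mod_cast hn
    nlinarith

theorem le_timeBound {κ : ℝ → ℝ} (hκ : ∀ t, 0 ≤ t → κ t ≤ kappaGV t) {A ε : ℝ} (hA : 0 ≤ A)
    (hε0 : 0 < ε) (hε1 : ε ≤ 1) (c n m d : ℕ) :
    A * n * Real.logb 2 n * (2 : ℝ) ^ ((1 - kappaGV ((d : ℝ) / m) - (d : ℝ) / m) * m) *
      (m : ℝ) ^ c ≤ timeBound κ A c ε n m d := by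
  have hδ : 0 ≤ (d : ℝ) / m := by positivity
  have hexp : 1 - kappaGV ((d : ℝ) / m) - (d : ℝ) / m ≤
      1 - κ ((1 + ε) * ((d : ℝ) / m)) - (d : ℝ) / m * H2 ((1 - ε) / 2) := by
    have hrate : κ ((1 + ε) * ((d : ℝ) / m)) ≤ kappaGV ((d : ℝ) / m) :=
      (hκ _ (by positivity)).trans
        (antitoneOn_kappaGV hδ (Set.mem_Ici.2 (by positivity)) (by nlinarith))
    linarith [mul_le_of_le_one_right hδ (H2_le_one ((1 - ε) / 2))]
  have hA_le : A ≤ A * ε⁻¹ := le_mul_of_one_le_right hA ((one_le_inv₀ hε0).2 hε1)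
  unfold timeBound
  gcongr
  · exact div_nonneg (Real.log_natCast_nonneg n) (Real.log_nonneg one_le_two)
  · exact logb_two_natCast_le_sq n
  · exact one_le_two

/-! ## The number of words handled by the search -/

/-- The number of binary words of length `m` in a Hamming ball of radius `ρ`. -/
def ballCard (m ρ : ℕ) : ℕ := ∑ l ∈ Finset.range (ρ + 1), m.choose l

theorem choose_le_two_rpow_of_two_mul_le {m d l : ℕ} (hd : 4 * d ≤ m) (hl : 2 * l ≤ d) :
    (m.choose l : ℝ) ≤ (2 : ℝ) ^ ((H2 ((d : ℝ) / m) - (d : ℝ) / m) * m) := by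
  rcases m.eq_zero_or_pos with rfl | hm
  · obtain rfl : l = 0 := by omega
    simp
  have hm0 : (0 : ℝ) < m := by exact_mod_cast hm
  have hd' : (d : ℝ) / m ≤ 1 / 4 := by
    rw [div_le_div_iff₀ hm0 four_pos]
    exact_mod_cast (by omega : d * 4 ≤ 1 * m)
  have hl' : (l : ℝ) / m ≤ (d : ℝ) / m / 2 := by
    rw [div_right_comm]
    gcongr
    rw [le_div_iff₀ two_pos]
    exact_mod_cast (by omega : l * 2 ≤ d)
  have hδ : 0 ≤ (d : ℝ) / m := by positivity
  have hexp : H2 ((l : ℝ) / m) ≤ H2 ((d : ℝ) / m) - (d : ℝ) / m := by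
    have := monotoneOn_H2 ⟨by positivity, by linarith⟩ ⟨by positivity, by linarith⟩ hl'
    linarith [H2_half_add_le hδ hd']
  obtain ⟨k, rfl⟩ := Nat.exists_eq_add_of_le (show l ≤ m by omega)
  calc ((l + k).choose l : ℝ) ≤ (2 : ℝ) ^ (H2 ((l : ℝ) / (l + k)) * (l + k)) :=
        choose_le_two_rpow_H2 l k
    _ ≤ _ := by
        push_cast at hexp ⊢
        gcongr
        exact one_le_two

theorem ballCard_le_of_four_mul_le {m d : ℕ} (hm : 1 ≤ m) (hd : 4 * d ≤ m) :
    (ballCard m ((d + 1) / 2) : ℝ) ≤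
      (m : ℝ) ^ 2 * (2 : ℝ) ^ ((H2 ((d : ℝ) / m) - (d : ℝ) / m) * m) := by
  set X := (2 : ℝ) ^ ((H2 ((d : ℝ) / m) - (d : ℝ) / m) * m)
  have hchoose (l : ℕ) (hl : l ∈ Finset.range ((d + 1) / 2 + 1)) : (m.choose l : ℝ) ≤ m * X := by
    have hl' : l ≤ (d + 1) / 2 := Nat.lt_succ_iff.1 (Finset.mem_range.1 hl)
    rcases l with _ | l
    · exact (choose_le_two_rpow_of_two_mul_le hd (Nat.zero_le d)).trans
        (le_mul_of_one_le_left (by positivity) (by exact_mod_cast hm))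
    · calc (m.choose (l + 1) : ℝ) ≤ m * m.choose l := by
            exact_mod_cast choose_succ_le_mul_choose m l
        _ ≤ m * X := by
            gcongr
            exact choose_le_two_rpow_of_two_mul_le hd (by omega)
  calc (ballCard m ((d + 1) / 2) : ℝ) = ∑ l ∈ Finset.range ((d + 1) / 2 + 1), (m.choose l : ℝ) := by
        rw [ballCard, Nat.cast_sum]
    _ ≤ ((d + 1) / 2 + 1 : ℕ) * (m * X) := by
        simpa using Finset.sum_le_card_nsmul _ _ _ hchoose
    _ ≤ m * (m * X) := by
        gcongr
        omega
    _ = m ^ 2 * X := by ring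

theorem card_mul_two_rpow_H2_le {n m e : ℕ} {x : Fin n → BVec m} (he : e + 1 ≤ m)
    (hx : Pairwise fun k l => 2 * e < hammingDist (x k) (x l)) :
    (n : ℝ) * (2 : ℝ) ^ (H2 (((e + 1 : ℕ) : ℝ) / m) * m) ≤ m * (m + 1) * 2 ^ m := by
  have hpack : n * m.choose e ≤ 2 ^ m := by
    simpa using sphere_packing_bound hx
  have hchoose : (n : ℝ) * m.choose (e + 1) ≤ m * 2 ^ m := by
    calc (n : ℝ) * m.choose (e + 1) ≤ n * (m * m.choose e) := by
          exact_mod_cast Nat.mul_le_mul_left n (choose_succ_le_mul_choose m e)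
      _ = m * (n * m.choose e) := by ring
      _ ≤ m * 2 ^ m := by exact_mod_cast Nat.mul_le_mul_left m hpack
  have hH2 : (2 : ℝ) ^ (H2 (((e + 1 : ℕ) : ℝ) / m) * m) ≤ (m + 1) * m.choose (e + 1) := by
    obtain ⟨k, rfl⟩ := Nat.exists_eq_add_of_le he
    simpa using two_rpow_H2_le_choose (e + 1) k
  calc (n : ℝ) * (2 : ℝ) ^ (H2 (((e + 1 : ℕ) : ℝ) / m) * m)
      ≤ n * ((m + 1) * m.choose (e + 1)) := by gcongr
    _ = (m + 1) * (n * m.choose (e + 1)) := by ring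
    _ ≤ (m + 1) * (m * 2 ^ m) := by gcongr
    _ = m * (m + 1) * 2 ^ m := by ring

theorem card_le_of_quarter_le {n m d : ℕ} {x : Fin n → BVec m} (h4 : m ≤ 4 * d)
    (h2 : 2 * d < m) (hx : Pairwise fun k l => d ≤ hammingDist (x k) (x l)) :
    (n : ℝ) ≤ m * (m + 1) * (2 : ℝ) ^ ((H2 ((d : ℝ) / m) - (d : ℝ) / m) * m) := by
  have hm0 : (0 : ℝ) < m := by exact_mod_cast (by omega : 0 < m)
  have hδ4 : 1 / 4 ≤ (d : ℝ) / m := by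
    rw [div_le_div_iff₀ four_pos hm0]
    exact_mod_cast (by omega : 1 * m ≤ d * 4)
  have hδ2 : (d : ℝ) / m ≤ 1 / 2 := by
    rw [div_le_div_iff₀ hm0 two_pos]
    exact_mod_cast (by omega : d * 2 ≤ 1 * m)
  obtain ⟨e, he⟩ : ∃ e, (d + 1) / 2 = e + 1 := Nat.exists_eq_succ_of_ne_zero (by omega)
  have hmono : H2 ((d : ℝ) / m / 2) ≤ H2 (((e + 1 : ℕ) : ℝ) / m) := by
    have hle : (d : ℝ) / m / 2 ≤ ((e + 1 : ℕ) : ℝ) / m := by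
      rw [div_right_comm]
      gcongr
      rw [div_le_iff₀ two_pos]
      exact_mod_cast (by omega : d ≤ (e + 1) * 2)
    have hle_half : ((e + 1 : ℕ) : ℝ) / m ≤ 1 / 2 := by
      rw [div_le_div_iff₀ hm0 two_pos]
      exact_mod_cast (by omega : (e + 1) * 2 ≤ 1 * m)
    exact monotoneOn_H2 ⟨by positivity, by linarith⟩ ⟨by positivity, hle_half⟩ hle
  have hexp : (m : ℝ) ≤ (H2 ((d : ℝ) / m) - (d : ℝ) / m) * m + H2 (((e + 1 : ℕ) : ℝ) / m) * m := by
    nlinarith [one_add_le_H2_add_H2_half hδ4 hδ2]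
  have hpack := card_mul_two_rpow_H2_le (e := e) (x := x) (by omega)
    (hx.mono fun k l h => by omega)
  refine le_of_mul_le_mul_right (hpack.trans ?_)
    (Real.rpow_pos_of_pos two_pos (H2 (((e + 1 : ℕ) : ℝ) / m) * m))
  rw [mul_assoc _ ((2 : ℝ) ^ _), ← Real.rpow_add two_pos, ← Real.rpow_natCast 2 m]
  gcongr
  exact one_le_two

theorem card_le_of_half_le {n m d : ℕ} {x : Fin n → BVec m} (hm : 1 ≤ m) (h2 : m ≤ 2 * d)
    (hdm : d ≤ m) (hx : Pairwise fun k l => d ≤ hammingDist (x k) (x l)) :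
    (n : ℝ) ≤ 2 * (2 : ℝ) ^ ((1 - (d : ℝ) / m) * m) := by
  have hm0 : (m : ℝ) ≠ 0 := by exact_mod_cast (by omega : m ≠ 0)
  have hsingleton : n ≤ 2 ^ (m + 1 - d) := by
    simpa using singleton_bound (by omega) hx
  calc (n : ℝ) ≤ 2 ^ (m - d + 1) := by
        rw [← Nat.sub_add_comm hdm]
        exact_mod_cast hsingleton
    _ = 2 * (2 : ℝ) ^ ((1 - (d : ℝ) / m) * m) := by
        rw [pow_succ', ← Real.rpow_natCast, Nat.cast_sub hdm, sub_mul, one_mul,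
          div_mul_cancel₀ _ hm0]

theorem min_card_ballCard_le {n m d : ℕ} {x : Fin n → BVec m} (hm : 1 ≤ m) (hdm : d ≤ m)
    (hx : Pairwise fun k l => d ≤ hammingDist (x k) (x l)) :
    (min n (ballCard m ((d + 1) / 2)) : ℝ) ≤
      2 * (m : ℝ) ^ 2 * (2 : ℝ) ^ ((1 - kappaGV ((d : ℝ) / m) - (d : ℝ) / m) * m) := by
  have hm1 : (1 : ℝ) ≤ m := by exact_mod_cast hm
  have hδ : (d : ℝ) / m < 1 / 2 ↔ 2 * d < m := by
    rw [div_lt_div_iff₀ (by linarith) two_pos, one_mul, mul_comm]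
    norm_cast
  rcases lt_or_ge (2 * d) m with h2 | h2
  · rw [kappaGV, if_pos (hδ.2 h2), sub_sub_cancel]
    rcases le_total (4 * d) m with h4 | h4
    · refine (min_le_right _ _).trans ((ballCard_le_of_four_mul_le hm h4).trans ?_)
      gcongr
      nlinarith
    · refine (min_le_left _ _).trans ((card_le_of_quarter_le h4 h2 hx).trans ?_)
      gcongr ?_ * _
      nlinarith
  · rw [kappaGV, if_neg (mt hδ.1 h2.not_gt), sub_zero]
    refine (min_le_left _ _).trans ((card_le_of_half_le hm h2 hdm hx).trans ?_)
    gcongr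
    nlinarith

/-! ## Words as numbers -/

section WordCodes

variable {m : ℕ}

/-- The bit of a word at a position, as a number. It is `0` beyond the end of the word. -/
def wordBit (w : BVec m) (t : ℕ) : ℕ := if h : t < m then (w ⟨t, h⟩).val else 0

theorem wordBit_val (w : BVec m) (t : Fin m) : wordBit w t = (w t).val := by
  simp [wordBit]

theorem wordBit_lt_two (w : BVec m) (t : ℕ) : wordBit w t < 2 := by
  unfold wordBit
  split_ifs
  · exact ZMod.val_lt _
  · exact two_pos

/-- The number with the binary digits `w 0, …, w (k - 1)`, least significant first. -/
def codeUpTo (w : BVec m) (k : ℕ) : ℕ := ∑ t ∈ Finset.range k, wordBit w t * 2 ^ t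

/-- The number by which a word is addressed, with the binary digits `w 0, …, w (m - 1)`. -/
def wordCode (w : BVec m) : ℕ := codeUpTo w m

theorem codeUpTo_succ (w : BVec m) (k : ℕ) :
    codeUpTo w (k + 1) = codeUpTo w k + wordBit w k * 2 ^ k :=
  Finset.sum_range_succ _ _

theorem codeUpTo_lt (w : BVec m) (k : ℕ) : codeUpTo w k < 2 ^ k := by
  induction k with
  | zero => simp [codeUpTo]
  | succ k ih =>
    have hbit : wordBit w k * 2 ^ k ≤ 1 * 2 ^ k :=
      Nat.mul_le_mul_right _ (Nat.lt_succ_iff.1 (wordBit_lt_two w k))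
    rw [codeUpTo_succ, pow_succ]
    omega

theorem wordCode_lt (w : BVec m) : wordCode w < 2 ^ m :=
  codeUpTo_lt w m

theorem wordCode_injective : Function.Injective (wordCode (m := m)) := by
  have hcode (w : BVec m) : finFunctionFinEquiv (m := 2) (n := m) w = wordCode w := by
    refine (finFunctionFinEquiv_apply _).trans ?_
    rw [wordCode, codeUpTo, Finset.sum_range]
    exact Finset.sum_congr rfl fun t _ => congrArg (· * 2 ^ (t : ℕ)) (wordBit_val w t).symm
  intro v w h
  rw [← hcode, ← hcode] at h
  exact finFunctionFinEquiv.injective (Fin.val_injective h)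

/-- Flip the bit at the position `k`. -/
def flipBit (w : BVec m) (k : ℕ) : BVec m := fun t => if (t : ℕ) = k then w t + 1 else w t

theorem flipBit_flipBit (w : BVec m) (k : ℕ) : flipBit (flipBit w k) k = w := by
  ext t
  simp only [flipBit]
  split_ifs
  · rw [add_assoc, CharTwo.add_self_eq_zero, add_zero]
  · rfl

theorem wordBit_flipBit_of_ne (w : BVec m) {k t : ℕ} (h : t ≠ k) :
    wordBit (flipBit w k) t = wordBit w t := by
  simp [wordBit, flipBit, h]

theorem wordBit_flipBit_self (w : BVec m) {k : ℕ} (h : k < m) :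
    wordBit (flipBit w k) k = 1 - wordBit w k := by
  have hval : ∀ a : ZMod 2, (a + 1).val = 1 - a.val := by decide
  simp [wordBit, flipBit, h, hval]

theorem wordCode_flipBit (w : BVec m) {k : ℕ} (h : k < m) :
    wordCode (flipBit w k) =
      if 0 < wordBit w k then wordCode w - 2 ^ k else wordCode w + 2 ^ k := by
  have hsplit (v : BVec m) : wordCode v =
      wordBit v k * 2 ^ k + ∑ t ∈ (Finset.range m).erase k, wordBit v t * 2 ^ t :=
    (Finset.add_sum_erase _ _ (Finset.mem_range.2 h)).symm
  have hrest : ∑ t ∈ (Finset.range m).erase k, wordBit (flipBit w k) t * 2 ^ t =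
      ∑ t ∈ (Finset.range m).erase k, wordBit w t * 2 ^ t :=
    Finset.sum_congr rfl fun t ht => by rw [wordBit_flipBit_of_ne w (Finset.ne_of_mem_erase ht)]
  rw [hsplit, hsplit w, hrest, wordBit_flipBit_self w h]
  have := wordBit_lt_two w k
  interval_cases wordBit w k
  · simp [add_comm]
  · simp

/-- The number of positions below `k` at which two words differ. -/
def distUpTo (v w : BVec m) (k : ℕ) : ℕ :=
  ∑ t ∈ Finset.range k, if wordBit v t = wordBit w t then 0 else 1

theorem distUpTo_succ (v w : BVec m) (k : ℕ) :
    distUpTo v w (k + 1) = distUpTo v w k + if wordBit v k = wordBit w k then 0 else 1 :=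
  Finset.sum_range_succ _ _

theorem distUpTo_le (v w : BVec m) (k : ℕ) : distUpTo v w k ≤ k := by
  induction k with
  | zero => exact Nat.le_refl 0
  | succ k ih =>
    rw [distUpTo_succ]
    split_ifs <;> omega

theorem distUpTo_eq_hammingDist (v w : BVec m) : distUpTo v w m = hammingDist v w := by
  rw [distUpTo, Finset.sum_range, hammingDist, Finset.card_filter]
  refine Finset.sum_congr rfl fun t _ => ?_
  simp only [wordBit_val, (ZMod.val_injective 2).eq_iff, ite_not, ne_eq]

theorem hammingDist_flipBit_le (w : BVec m) (k : ℕ) : hammingDist (flipBit w k) w ≤ 1 := by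
  refine Finset.card_le_one.2 fun a ha b hb => ?_
  have hflipped (t : Fin m) (ht : flipBit w k t ≠ w t) : (t : ℕ) = k :=
    by_contra fun h => ht (if_neg h)
  exact Fin.ext ((hflipped a (by simpa using ha)).trans (hflipped b (by simpa using hb)).symm)

theorem flipBit_apply_self_of_ne {v w : BVec m} {q : Fin m} (h : w q ≠ v q) :
    flipBit w q q = v q := by
  have hflip : ∀ a b : ZMod 2, a ≠ b → a + 1 = b := by decide
  rw [flipBit, if_pos rfl, hflip _ _ h]

theorem hammingDist_flipBit_of_ne {v w : BVec m} {q : Fin m} (h : w q ≠ v q) :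
    hammingDist (flipBit w q) v = hammingDist w v - 1 := by
  have herase : ({t | flipBit w q t ≠ v t} : Finset (Fin m)) =
      ({t | w t ≠ v t} : Finset (Fin m)).erase q := by
    ext t
    rcases eq_or_ne t q with rfl | htq
    · simp [flipBit_apply_self_of_ne h]
    · simp [flipBit, htq, Fin.val_inj]
  exact (congrArg Finset.card herase).trans (Finset.card_erase_of_mem (by simpa using h))

theorem exists_last_ne {v w : BVec m} (h : w ≠ v) : ∃ q, w q ≠ v q ∧ ∀ t, q < t → w t = v t := by
  obtain ⟨q, hq, hmax⟩ := Finset.exists_max_image ({t | w t ≠ v t} : Finset (Fin m)) id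
    (by obtain ⟨t, ht⟩ := Function.ne_iff.1 h; exact ⟨t, by simpa using ht⟩)
  refine ⟨q, by simpa using hq, fun t hqt => ?_⟩
  by_contra ht
  exact (hmax t (by simpa using ht)).not_gt hqt

end WordCodes

/-! ## The search in Hamming balls -/

/-- A word found by the search, together with the index of the input vector `src` from which it was
reached and a bound `pos` on the flipped positions: they are flipped in increasing order, so that
every word of a ball is reached exactly once. -/
structure Item (n m : ℕ) where
  word : BVec m
  pos : ℕ
  src : Fin n

section Search

variable {n m : ℕ}

/-- The item reached from `e` by flipping the bit `k` next. -/
def Item.child (e : Item n m) (k : ℕ) : Item n m := ⟨flipBit e.word k, k + 1, e.src⟩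

/-- The items reached from `e` by flipping one more bit. -/
def Item.children (e : Item n m) : List (Item n m) :=
  (List.range' e.pos (m - e.pos)).map e.child

/-- The `l`-th level of the search: the words at distance `l` from the vectors `x`. -/
def searchLevel (x : Fin n → BVec m) : ℕ → List (Item n m)
  | 0 => (List.finRange n).map fun i => ⟨x i, 0, i⟩
  | l + 1 => (searchLevel x l).flatMap Item.children

/-- The items found by the search up to the level `ρ`, in the order of their discovery. -/
def searchUpTo (x : Fin n → BVec m) : ℕ → List (Item n m)
  | 0 => searchLevel x 0
  | ρ + 1 => searchUpTo x ρ ++ searchLevel x (ρ + 1)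

/-- The word of `e` arises from that of its source by flipping at most `l` bits below `e.pos`. -/
structure Item.Valid (x : Fin n → BVec m) (l : ℕ) (e : Item n m) : Prop where
  dist_le : hammingDist e.word (x e.src) ≤ l
  pos_le : e.pos ≤ m
  agree : ∀ t, e.pos ≤ t → wordBit e.word t = wordBit (x e.src) t

variable {x : Fin n → BVec m} {l ρ : ℕ} {e : Item n m}

theorem Item.mem_children {e' : Item n m} :
    e' ∈ e.children ↔ ∃ k, e.pos ≤ k ∧ k < m ∧ e.child k = e' := by
  simp only [Item.children, List.mem_map, List.mem_range'_1]
  refine exists_congr fun k => ?_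
  rw [← and_assoc]
  refine and_congr_left fun _ => ?_
  omega

theorem Item.Valid.child (h : e.Valid x l) {k : ℕ} (hk : e.pos ≤ k) (hkm : k < m) :
    (e.child k).Valid x (l + 1) where
  dist_le := by
    have htri := hammingDist_triangle (flipBit e.word k) e.word (x e.src)
    have hflip := hammingDist_flipBit_le e.word k
    have := h.dist_le
    simp only [Item.child]
    omega
  pos_le := hkm
  agree t ht := by
    simp only [Item.child] at ht ⊢
    rw [wordBit_flipBit_of_ne _ (by omega), h.agree t (by omega)]

theorem valid_of_mem_searchLevel (h : e ∈ searchLevel x l) : e.Valid x l := by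
  induction l generalizing e with
  | zero =>
    obtain ⟨i, -, rfl⟩ := List.mem_map.1 h
    exact ⟨(hammingDist_self _).le, Nat.zero_le m, fun _ _ => rfl⟩
  | succ l ih =>
    obtain ⟨e', he', h⟩ := List.mem_flatMap.1 h
    obtain ⟨k, hk, hkm, rfl⟩ := Item.mem_children.1 h
    exact (ih he').child hk hkm

theorem mem_searchUpTo : e ∈ searchUpTo x ρ ↔ ∃ l ≤ ρ, e ∈ searchLevel x l := by
  induction ρ with
  | zero => simp [searchUpTo]
  | succ ρ ih => simp only [searchUpTo, List.mem_append, ih, Nat.le_succ_iff, or_and_right,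
      exists_or, exists_eq_left, Nat.succ_eq_add_one]

theorem exists_mem_searchLevel {w : BVec m} {i : Fin n} (hl : hammingDist w (x i) = l) {p : ℕ}
    (hp : ∀ t : Fin m, p ≤ t → w t = x i t) :
    ∃ e ∈ searchLevel x l, e.word = w ∧ e.src = i ∧ e.pos ≤ p := by
  induction l generalizing w p with
  | zero =>
    exact ⟨⟨x i, 0, i⟩, List.mem_map_of_mem (List.mem_finRange i),
      (hammingDist_eq_zero.1 hl).symm, rfl, Nat.zero_le p⟩
  | succ l ih =>
    obtain ⟨q, hq, hlast⟩ := exists_last_ne (hammingDist_ne_zero.1 (by omega) : w ≠ x i)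
    obtain ⟨e, he, hword, hsrc, hpos⟩ := ih (w := flipBit w q) (p := q)
      (by rw [hammingDist_flipBit_of_ne hq, hl, Nat.add_sub_cancel]) fun t ht => by
        rcases (Fin.le_def.2 ht).eq_or_lt with rfl | hqt
        · exact flipBit_apply_self_of_ne hq
        · rw [flipBit, if_neg (Fin.lt_def.1 hqt).ne', hlast t hqt]
    refine ⟨e.child q, ?_, by rw [Item.child, hword, flipBit_flipBit], hsrc, ?_⟩
    · exact List.mem_flatMap.2 ⟨e, he, Item.mem_children.2 ⟨q, hpos, q.2, rfl⟩⟩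
    · exact Nat.succ_le_of_lt (lt_of_not_ge fun hpq => hq (hp q hpq))

theorem sum_choose_range' {q p : ℕ} (h : p + q = m) (j : ℕ) :
    ((List.range' p q).map fun k => (m - (k + 1)).choose j).sum = q.choose (j + 1) := by
  induction q generalizing p with
  | zero => simp
  | succ q ih =>
    rw [List.range'_succ, List.map_cons, List.sum_cons, ih (by omega),
      show m - (p + 1) = q by omega, Nat.choose_succ_succ]

theorem sum_choose_searchLevel (x : Fin n → BVec m) (l j : ℕ) :
    ((searchLevel x l).map fun e => (m - e.pos).choose j).sum = n * m.choose (l + j) := by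
  induction l generalizing j with
  | zero => simp [searchLevel, Function.comp_def]
  | succ l ih =>
    rw [searchLevel, List.map_flatMap, List.flatMap_def, List.sum_flatten, List.map_map,
      Nat.succ_add_eq_add_succ, ← ih]
    refine congrArg List.sum (List.map_congr_left fun e he => ?_)
    have := (valid_of_mem_searchLevel he).pos_le
    rw [Function.comp_apply, Item.children, List.map_map]
    exact sum_choose_range' (by omega) j

theorem length_searchLevel (x : Fin n → BVec m) (l : ℕ) :
    (searchLevel x l).length = n * m.choose l := by
  simpa using sum_choose_searchLevel x l 0

theorem length_searchUpTo (x : Fin n → BVec m) (ρ : ℕ) :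
    (searchUpTo x ρ).length = n * ballCard m ρ := by
  induction ρ with
  | zero => simp [searchUpTo, length_searchLevel, ballCard]
  | succ ρ ih =>
    rw [searchUpTo, List.length_append, ih, length_searchLevel, ballCard, ballCard,
      Finset.sum_range_succ _ (ρ + 1), mul_add]

theorem ballCard_mono (m : ℕ) : Monotone (ballCard m) := fun _ _ h =>
  Finset.sum_le_sum_of_subset (Finset.range_mono (Nat.succ_le_succ h))

theorem ballCard_le_two_pow (m ρ : ℕ) : ballCard m ρ ≤ 2 ^ m := by
  calc ballCard m ρ ≤ ballCard m (ρ + m) := ballCard_mono m (Nat.le_add_right ρ m)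
    _ = ballCard m m :=
        (Finset.sum_subset (Finset.range_mono (by omega)) fun l _ hl =>
          Nat.choose_eq_zero_of_lt (by simpa using hl)).symm
    _ = 2 ^ m := Nat.sum_range_choose m

/-! ## Collisions -/

/-- The index of the vector from which the word `w` was reached first, if `w` was met at all. -/
def firstSource (P : List (Item n m)) (w : BVec m) : Option (Fin n) :=
  (P.find? fun e => e.word = w).map Item.src

variable {P : List (Item n m)} {w : BVec m} {s : Fin n}

theorem exists_mem_of_firstSource_eq_some (h : firstSource P w = some s) :
    ∃ e ∈ P, e.word = w ∧ e.src = s := by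
  obtain ⟨e, he, rfl⟩ := Option.map_eq_some_iff.1 h
  exact ⟨e, List.mem_of_find?_eq_some he, by simpa using List.find?_some he, rfl⟩

theorem exists_firstSource_eq_some (h : e ∈ P) : ∃ s, firstSource P e.word = some s := by
  rw [← Option.isSome_iff_exists, firstSource, Option.isSome_map, List.find?_isSome]
  exact ⟨e, h, by simp⟩

theorem firstSource_append (P Q : List (Item n m)) (w : BVec m) :
    firstSource (P ++ Q) w = (firstSource P w).or (firstSource Q w) := by
  rw [firstSource, List.find?_append, Option.map_or, firstSource, firstSource]

theorem firstSource_append_singleton (P : List (Item n m)) (e : Item n m) (w : BVec m) :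
    firstSource (P ++ [e]) w = (firstSource P w).or (if e.word = w then some e.src else none) := by
  rw [firstSource_append]
  congr 1
  by_cases h : e.word = w <;> simp [firstSource, h]

theorem firstSource_searchUpTo_mono {σ : ℕ} (h : ρ ≤ σ)
    (hw : firstSource (searchUpTo x ρ) w = some s) : firstSource (searchUpTo x σ) w = some s := by
  induction σ, h using Nat.le_induction with
  | base => exact hw
  | succ σ _ ih => rw [searchUpTo, firstSource_append, ih, Option.some_or]

/-- The contents of the table cell of the word `w` after the items in `P` have been inserted. The
cells of the words that have not been met contain `0`; the others contain the successor of the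
address of the vector from which the word was reached first. -/
def tableEntry (P : List (Item n m)) (w : BVec m) : ℕ :=
  ((firstSource P w).map fun s : Fin n => s * m + 1).getD 0

theorem tableEntry_of_firstSource (h : firstSource P w = some s) :
    tableEntry P w = s * m + 1 := by
  rw [tableEntry, h, Option.map_some, Option.getD_some]

theorem tableEntry_of_firstSource_none (h : firstSource P w = none) : tableEntry P w = 0 := by
  rw [tableEntry, h, Option.map_none, Option.getD_none]

theorem tableEntry_append_of_firstSource (h : firstSource P e.word = some s) (w : BVec m) :
    tableEntry (P ++ [e]) w = tableEntry P w := by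
  rw [tableEntry, tableEntry, firstSource_append_singleton]
  split_ifs with hw
  · rw [← hw, h, Option.some_or]
  · rw [Option.or_none]

theorem tableEntry_append_of_firstSource_none (h : firstSource P e.word = none) (w : BVec m) :
    tableEntry (P ++ [e]) w = if w = e.word then e.src * m + 1 else tableEntry P w := by
  rw [tableEntry, tableEntry, firstSource_append_singleton]
  by_cases hw : w = e.word
  · rw [if_pos hw, hw, h, if_pos rfl, Option.none_or, Option.map_some, Option.getD_some]
  · rw [if_neg hw, if_neg (Ne.symm hw), Option.or_none]

/-- The number `b` is at most the distance of any two vectors from which the same word was reached,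
where one of the two is the first one to reach the word. -/
def Covers (x : Fin n → BVec m) (P : List (Item n m)) (b : ℕ) : Prop :=
  ∀ e ∈ P, ∀ s, firstSource P e.word = some s → s ≠ e.src → b ≤ hammingDist (x s) (x e.src)

/-- The number `b` is infinite, encoded as `m + 1`, or the distance of the two vectors stored from
the addresses `a` and `a'` on, in this order. -/
def Attained (x : Fin n → BVec m) (b a a' : ℕ) : Prop :=
  b = m + 1 ∨ ∃ i j : Fin n, i < j ∧ a = i * m ∧ a' = j * m ∧ b = hammingDist (x i) (x j)

variable {b : ℕ}

theorem Covers.mono (h : Covers x P b) {b' : ℕ} (hb : b' ≤ b) : Covers x P b' :=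
  fun e he s hs hne => hb.trans (h e he s hs hne)

theorem Covers.append_singleton (h : Covers x P b)
    (he : ∀ s, firstSource P e.word = some s → s ≠ e.src → b ≤ hammingDist (x s) (x e.src)) :
    Covers x (P ++ [e]) b := by
  intro f hf s hs hne
  rw [firstSource_append_singleton] at hs
  rcases List.mem_append.1 hf with hfP | hfe
  · obtain ⟨s', hs'⟩ := exists_firstSource_eq_some hfP
    rw [hs', Option.some_or] at hs
    exact h f hfP s (hs'.trans hs) hne
  · obtain rfl := List.mem_singleton.1 hfe
    rw [if_pos rfl] at hs
    rcases hP : firstSource P f.word with _ | s'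
    · simp [hP] at hs
      exact absurd hs.symm hne
    · rw [hP, Option.some_or] at hs
      exact he s (hP.trans hs) hne

theorem firstSource_searchUpTo_dist_le (h : firstSource (searchUpTo x ρ) w = some s) :
    hammingDist w (x s) ≤ ρ := by
  obtain ⟨e, he, rfl, rfl⟩ := exists_mem_of_firstSource_eq_some h
  obtain ⟨l, hl, he⟩ := mem_searchUpTo.1 he
  exact (valid_of_mem_searchLevel he).dist_le.trans hl

theorem exists_mem_searchUpTo {i : Fin n} (h : hammingDist w (x i) ≤ ρ) :
    ∃ e ∈ searchUpTo x ρ, e.word = w ∧ e.src = i := by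
  obtain ⟨e, he, hword, hsrc, -⟩ := exists_mem_searchLevel (x := x) (w := w) (i := i) rfl (p := m)
    fun t ht => absurd t.2 ht.not_gt
  exact ⟨e, mem_searchUpTo.2 ⟨_, h, he⟩, hword, hsrc⟩

variable {i j : Fin n}

/-- A word half-way between the closest pair lies in the balls around both vectors, and by
uniqueness the vector that reaches it first is one of the two. -/
theorem Covers.le_hammingDist (hx : IsUniqueClosestPair x i j) (h : Covers x (searchUpTo x ρ) b)
    (hρ : hammingDist (x i) (x j) ≤ 2 * ρ) : b ≤ hammingDist (x i) (x j) := by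
  obtain ⟨w, hw⟩ : (betweenWords (x i) (x j) (hammingDist (x i) (x j) / 2)).Nonempty :=
    betweenWords_nonempty (Nat.div_le_self _ _)
  have hwi := hammingDist_left_of_mem_betweenWords hw
  have hwj := hammingDist_right_of_mem_betweenWords hw
  set d := hammingDist (x i) (x j)
  obtain ⟨ei, hei, rfl, -⟩ := exists_mem_searchUpTo (x := x) (i := i) (ρ := d / 2) hwi.le
  obtain ⟨s, hs⟩ := exists_firstSource_eq_some hei
  have hsi : hammingDist (x s) (x i) ≤ d := by
    have := firstSource_searchUpTo_dist_le hs
    have := hammingDist_triangle_left (x s) (x i) ei.word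
    omega
  replace hs := firstSource_searchUpTo_mono (by omega : d / 2 ≤ ρ) hs
  have hcover {k : Fin n} (hk : hammingDist ei.word (x k) ≤ ρ) (hsk : s ≠ k) :
      b ≤ hammingDist (x s) (x k) := by
    obtain ⟨e, he, hword, rfl⟩ := exists_mem_searchUpTo hk
    exact h e he s (by rwa [hword]) hsk
  by_cases hsi_eq : s = i
  · subst hsi_eq
    exact hcover (by omega) hx.1.ne
  · exact (hcover (by omega) hsi_eq).trans hsi

theorem Attained.hammingDist_le {a a' : ℕ} (hx : IsUniqueClosestPair x i j)
    (h : Attained x b a a') : hammingDist (x i) (x j) ≤ b := by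
  rcases h with rfl | ⟨k, l, hkl, rfl, rfl, rfl⟩
  · exact (hammingDist_le_card_fintype.trans_eq (Fintype.card_fin m)).trans m.le_succ
  · exact hx.hammingDist_le hkl.ne

theorem Attained.eq_of_le {a a' : ℕ} (hx : IsUniqueClosestPair x i j) (h : Attained x b a a')
    (hb : b ≤ hammingDist (x i) (x j)) :
    a = i * m ∧ a' = j * m ∧ b = hammingDist (x i) (x j) := by
  rcases h with rfl | ⟨k, l, hkl, rfl, rfl, rfl⟩
  · have := hammingDist_le_card_fintype (x := x i) (y := x j)
    rw [Fintype.card_fin] at this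
    omega
  · rcases hx.eq_of_hammingDist_le hkl.ne hb with ⟨rfl, rfl⟩ | ⟨rfl, rfl⟩
    · exact ⟨rfl, rfl, rfl⟩
    · exact absurd hkl hx.1.not_gt

end Search

/-! ## Reasoning about programs -/

/-- Write `c` into the heap cell `a`. -/
def RAMState.put (s : RAMState) (a c : ℕ) : RAMState :=
  { s with heap := Function.update s.heap a c }

@[simp]
theorem RAMState.vars_set (s : RAMState) (v c w : ℕ) :
    (s.set v c).vars w = if w = v then c else s.vars w :=
  Function.update_apply _ _ _ _

@[simp]
theorem RAMState.heap_put (s : RAMState) (a c p : ℕ) :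
    (s.put a c).heap p = if p = a then c else s.heap p :=
  Function.update_apply _ _ _ _

@[simp]
theorem RAMState.heap_set (s : RAMState) (v c : ℕ) : (s.set v c).heap = s.heap := rfl

@[simp]
theorem RAMState.vars_put (s : RAMState) (a c : ℕ) : (s.put a c).vars = s.vars := rfl

/-- All numbers in the memory have at most `L` bits. -/
structure RAMState.Bounded (L : ℕ) (s : RAMState) : Prop where
  vars_lt (v : ℕ) : s.vars v < 2 ^ L
  heap_lt (a : ℕ) : s.heap a < 2 ^ L

theorem RAMState.Bounded.set {L : ℕ} {s : RAMState} (h : s.Bounded L) (v : ℕ) {c : ℕ}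
    (hc : c < 2 ^ L) : (s.set v c).Bounded L where
  vars_lt w := by
    rw [RAMState.vars_set]
    split_ifs
    exacts [hc, h.vars_lt w]
  heap_lt := h.heap_lt

theorem RAMState.Bounded.put {L : ℕ} {s : RAMState} (h : s.Bounded L) (a : ℕ) {c : ℕ}
    (hc : c < 2 ^ L) : (s.put a c).Bounded L where
  vars_lt := h.vars_lt
  heap_lt p := by
    rw [RAMState.heap_put]
    split_ifs
    exacts [hc, h.heap_lt p]

theorem bitCost_le {L a : ℕ} (h : a < 2 ^ L) : bitCost a ≤ L + 1 :=
  Nat.succ_le_succ (Nat.size_le.2 h)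

theorem RAMState.Bounded.bitCost_vars_add_le {L : ℕ} {s : RAMState} (h : s.Bounded L) (a b : ℕ) :
    bitCost (s.vars a) + bitCost (s.vars b) ≤ 2 * L + 2 := by
  have := bitCost_le (h.vars_lt a)
  have := bitCost_le (h.vars_lt b)
  omega

/-- Whether the program contains an instruction that assigns a value to the variable `v`. -/
def Cmd.assigns (v : ℕ) : Cmd → Bool
  | .const w _ | .add w _ _ | .sub w _ _ | .load w _ | .flip w => w == v
  | .seq p q | .ite _ _ p q => p.assigns v || q.assigns v
  | .loop _ _ p => p.assigns v
  | .skip | .store _ _ | .query _ _ _ => false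

/-- Whether the program contains an instruction that writes into the heap. -/
def Cmd.writesHeap : Cmd → Bool
  | .store _ _ | .query _ _ _ => true
  | .seq p q | .ite _ _ p q => p.writesHeap || q.writesHeap
  | .loop _ _ p => p.writesHeap
  | _ => false

/-- The states `s` and `s'` differ only in parts of the memory into which the text of the program
`p` allows it to write. -/
structure Frame (p : Cmd) (s s' : RAMState) : Prop where
  vars_eq (v : ℕ) (hv : p.assigns v = false := by rfl) : s'.vars v = s.vars v
  heap_eq (hp : p.writesHeap = false := by rfl) : s'.heap = s.heap

theorem Frame.refl (p : Cmd) (s : RAMState) : Frame p s s := ⟨fun _ _ => rfl, fun _ => rfl⟩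

theorem Frame.trans {p : Cmd} {s s' s'' : RAMState} (h : Frame p s s') (h' : Frame p s' s'') :
    Frame p s s'' :=
  ⟨fun v hv => (h'.vars_eq v hv).trans (h.vars_eq v hv),
    fun hp => (h'.heap_eq hp).trans (h.heap_eq hp)⟩

theorem Frame.mono {p q : Cmd} {s s' : RAMState} (h : Frame p s s')
    (hv : ∀ v, q.assigns v = false → p.assigns v = false)
    (hh : q.writesHeap = false → p.writesHeap = false) : Frame q s s' :=
  ⟨fun v hq => h.vars_eq v (hv v hq), fun hq => h.heap_eq (hh hq)⟩

theorem Frame.set {p : Cmd} (s : RAMState) {v : ℕ} (c : ℕ) (hv : p.assigns v = true) :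
    Frame p s (s.set v c) where
  vars_eq w hw := by
    rw [RAMState.vars_set, if_neg]
    rintro rfl
    simp [hv] at hw
  heap_eq _ := rfl

theorem Exec.frame {m : ℕ} {D : ℕ → BVec m → BVec m} {p : Cmd} {s s' : RAMState} {t : ℕ}
    (h : Exec D p s s' t) : Frame p s s' := by
  induction h with
  | skip s => exact .refl _ s
  | const s | add s | sub s | load s => exact .set s _ (beq_self_eq_true _)
  | store s | query s => exact ⟨fun _ _ => rfl, fun h => absurd h (by simp [Cmd.writesHeap])⟩
  | flip s v =>
    have := Frame.set (p := .flip v) s (s.coins 0).toNat (beq_self_eq_true v)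
    exact ⟨fun w hw => this.vars_eq w hw, fun _ => rfl⟩
  | seq _ _ ih ih' =>
    exact (ih.mono (by simp +contextual [Cmd.assigns]) (by simp +contextual [Cmd.writesHeap])).trans
      (ih'.mono (by simp +contextual [Cmd.assigns]) (by simp +contextual [Cmd.writesHeap]))
  | iteTrue _ _ ih | iteFalse _ _ ih =>
    exact ih.mono (by simp +contextual [Cmd.assigns]) (by simp +contextual [Cmd.writesHeap])
  | loopTrue _ _ _ ih ih' => exact Frame.trans (ih.mono (fun _ => id) id) ih'
  | loopFalse => exact .refl _ _

/-- Started in the state `s`, if this contains only numbers of at most `L` bits, the program `p`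
halts after at most `N` instructions in a state that satisfies `Q`, and it never produces a number
of more than `L` bits. -/
def Run {m : ℕ} (D : ℕ → BVec m → BVec m) (L : ℕ) (p : Cmd) (s : RAMState) (N : ℕ)
    (Q : RAMState → Prop) : Prop :=
  s.Bounded L → ∃ s' t, Exec D p s s' t ∧ t ≤ N * (2 * L + 2) ∧ s'.Bounded L ∧ Q s'

namespace Run

variable {m : ℕ} {D : ℕ → BVec m → BVec m} {L N N' : ℕ} {p q : Cmd} {s : RAMState}
  {v a b c : ℕ} {Q R : RAMState → Prop}

theorem le (h : Run D L p s N Q) (hN : N ≤ N') : Run D L p s N' Q := fun hs =>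
  let ⟨s', t, hexec, ht, hs', hQ⟩ := h hs
  ⟨s', t, hexec, ht.trans (Nat.mul_le_mul_right _ hN), hs', hQ⟩

theorem imp (h : Run D L p s N R) (hQ : ∀ s', Frame p s s' → R s' → Q s') : Run D L p s N Q :=
  fun hs =>
    let ⟨s', t, hexec, ht, hs', hR⟩ := h hs
    ⟨s', t, hexec, ht, hs', hQ s' hexec.frame hR⟩

theorem of_exec {t : ℕ} {s' : RAMState} (hexec : Exec D p s s' t)
    (ht : s.Bounded L → t ≤ 2 * L + 2) (hs' : s.Bounded L → s'.Bounded L) (hQ : Q s') :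
    Run D L p s (N + 1) Q := fun hs =>
  ⟨s', t, hexec, (ht hs).trans (Nat.le_mul_of_pos_left _ N.succ_pos), hs' hs, hQ⟩

theorem skip (h : Q s) : Run D L .skip s (N + 1) Q :=
  of_exec (.skip s) (fun _ => by omega) id h

theorem const (hc : c < 2 ^ L) (h : Q (s.set v c)) : Run D L (.const v c) s (N + 1) Q :=
  of_exec (.const s v c) (fun _ => (bitCost_le hc).trans (by omega)) (fun hs => hs.set v hc) h

theorem add (hc : s.vars a + s.vars b = c) (hcL : c < 2 ^ L) (h : Q (s.set v c)) :
    Run D L (.add v a b) s (N + 1) Q := by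
  subst hc
  exact of_exec (.add s v a b) (fun hs => hs.bitCost_vars_add_le a b) (fun hs => hs.set v hcL) h

theorem sub (hc : s.vars a - s.vars b = c) (h : Q (s.set v c)) :
    Run D L (.sub v a b) s (N + 1) Q := by
  subst hc
  exact of_exec (.sub s v a b) (fun hs => hs.bitCost_vars_add_le a b)
    (fun hs => hs.set v ((Nat.sub_le _ _).trans_lt (hs.vars_lt a))) h

theorem load (hc : s.heap (s.vars a) = c) (h : Q (s.set v c)) :
    Run D L (.load v a) s (N + 1) Q := by
  subst hc
  refine of_exec (.load s v a) (fun hs => ?_) (fun hs => hs.set v (hs.heap_lt _)) h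
  have := bitCost_le (hs.vars_lt a)
  have := bitCost_le (hs.heap_lt (s.vars a))
  omega

theorem store {k : ℕ} (hk : s.vars a = k) (hc : s.vars b = c) (h : Q (s.put k c)) :
    Run D L (.store a b) s (N + 1) Q := by
  subst hk hc
  exact of_exec (.store s a b) (fun hs => hs.bitCost_vars_add_le a b)
    (fun hs => hs.put _ (hs.vars_lt b)) h

theorem seq (hp : Run D L p s N R) (hq : ∀ s', Frame p s s' → R s' → Run D L q s' N' Q) :
    Run D L (.seq p q) s (N + N') Q := by
  intro hs
  obtain ⟨s', t, hexec, ht, hs', hR⟩ := hp hs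
  obtain ⟨s'', t', hexec', ht', hs'', hQ⟩ := hq s' hexec.frame hR hs'
  exact ⟨s'', t + t', .seq hexec hexec', by rw [add_mul]; omega, hs'', hQ⟩

theorem step (h : Run D L p s 1 fun s' => Run D L q s' N Q) : Run D L (.seq p q) s (N + 1) Q :=
  (h.seq fun _ _ hq => hq).le (Nat.add_comm 1 N).le

theorem ite {k l : ℕ} (hk : s.vars a = k) (hl : s.vars b = l) (hp : k < l → Run D L p s N Q)
    (hq : l ≤ k → Run D L q s N Q) : Run D L (.ite a b p q) s (N + 1) Q := by
  subst hk hl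
  intro hs
  have hcost := hs.bitCost_vars_add_le a b
  by_cases hab : s.vars a < s.vars b
  · obtain ⟨s', t, hexec, ht, hrest⟩ := hp hab hs
    exact ⟨s', _, .iteTrue hab hexec, by rw [add_mul]; omega, hrest⟩
  · obtain ⟨s', t, hexec, ht, hrest⟩ := hq (not_lt.1 hab) hs
    exact ⟨s', _, .iteFalse hab hexec, by rw [add_mul]; omega, hrest⟩

/-- The number `k` counts the iterations that have been completed. -/
theorem loop {K : ℕ} (I : ℕ → RAMState → Prop) {k : ℕ} (hk : k ≤ K) (h : I k s)
    (hI : ∀ k u, Frame p s u → I k u → u.vars a < u.vars b → k < K ∧ Run D L p u N (I (k + 1))) :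
    Run D L (.loop a b p) s ((K - k) * (N + 1) + 1)
      fun u => ∃ k ≤ K, I k u ∧ u.vars b ≤ u.vars a := by
  obtain ⟨r, hr⟩ : ∃ r, r = K - k := ⟨_, rfl⟩
  rw [← hr]
  induction r generalizing k s with
  | zero =>
    intro hs
    have hab : ¬ s.vars a < s.vars b := fun hab => by
      have := (hI k s (.refl p s) h hab).1
      omega
    exact ⟨s, _, .loopFalse hab, by simpa using hs.bitCost_vars_add_le a b, hs, k, hk, h,
      not_lt.1 hab⟩
  | succ r ih =>
    intro hs
    have hcost := hs.bitCost_vars_add_le a b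
    by_cases hab : s.vars a < s.vars b
    · obtain ⟨hkK, hrun⟩ := hI k s (.refl p s) h hab
      obtain ⟨u, t, hexec, ht, hu, hIu⟩ := hrun hs
      obtain ⟨s', t', hexec', ht', hrest⟩ := ih hkK hIu
        (fun k' u' hu' => hI k' u' (hexec.frame.trans hu')) (by omega) hu
      refine ⟨s', _, .loopTrue hab hexec hexec', ?_, hrest⟩
      linear_combination hcost + ht + ht'
    · exact ⟨s, _, .loopFalse hab, hcost.trans (Nat.le_mul_of_pos_left _ (by omega)), hs, k, hk, h,
        not_lt.1 hab⟩

theorem forLoop (K : ℕ) (I : ℕ → RAMState → Prop) (h : I 0 s)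
    (hguard : ∀ k u, Frame p s u → I k u → (u.vars a < u.vars b ↔ k < K))
    (hI : ∀ k u, k < K → Frame p s u → I k u → Run D L p u N (I (k + 1))) :
    Run D L (.loop a b p) s (K * (N + 1) + 1) (I K) := by
  refine (loop (K := K) I K.zero_le h fun k u hu hIk hlt => ?_).imp ?_
  · have hk := (hguard k u hu hIk).1 hlt
    exact ⟨hk, hI k u hk hu hIk⟩
  · rintro u hu ⟨k, hk, hIk, hle⟩
    have hK : ¬ k < K := fun hlt => hle.not_gt
      ((hguard k u (hu.mono (fun _ => id) id) hIk).2 hlt)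
    rwa [← hk.antisymm (not_lt.1 hK)]

end Run

/-! ## The program -/

infixr:30 ";;" => Cmd.seq

/-- The variables of the program. It expects `n` and `m` in the first two and leaves the distance of
the closest pair in the third one. -/
inductive Reg : Type
  | numVectors | wordLength | best | one | zero | two | inputEnd | numPairs | tableStart
  | queueEnd | queueLength | bestLeft | bestRight | head | levelEnd | parent | pos | src | code
  | addr | bit | power | entry | curDist | idx | bitLeft | bitRight | left | right | diameter
  | limit | counter | quotient

/-- A variable of the program is referred to by its number. -/
instance : Coe Reg ℕ := ⟨Reg.ctorIdx⟩

open Reg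

/-- Compare the bits number `idx` of the vectors stored from the addresses `left` and `right` on. -/
def compareBitsCmd : Cmd :=
  .add addr left idx ;; .load bitLeft addr ;; .add addr right idx ;; .load bitRight addr ;;
  .ite bitLeft bitRight (.add curDist curDist one)
    (.ite bitRight bitLeft (.add curDist curDist one) .skip) ;;
  .add idx idx one

/-- Compute the distance of the vectors stored from the addresses `left` and `right` on. -/
def measureCmd : Cmd :=
  .const curDist 0 ;; .const idx 0 ;; .loop idx wordLength compareBitsCmd

/-- Compare the best pair with the pair of vectors stored from the addresses `left` and `right`
on. -/
def examineCmd : Cmd :=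
  measureCmd ;;
  .ite curDist best
    (.add best curDist zero ;; .add bestLeft left zero ;; .add bestRight right zero) .skip

/-- The address of the queue. -/
def queueBase (n m : ℕ) : ℕ := n * m + m + 2 ^ m

section Examine

variable {n m : ℕ}

/-- The variables that the search never assigns. -/
def constantRegs : List ℕ :=
  [numVectors, wordLength, one, zero, two, inputEnd, numPairs, tableStart]

/-- The part of the memory that the search never changes: the constants, the vectors from the
address `0` on and the powers of two behind them. -/
structure Ready (x : Fin n → BVec m) (s : RAMState) : Prop where
  numVectors : s.vars numVectors = n
  wordLength : s.vars wordLength = m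
  one : s.vars one = 1
  zero : s.vars zero = 0
  two : s.vars two = 2
  inputEnd : s.vars inputEnd = n * m
  numPairs : s.vars numPairs = n * n
  tableStart : s.vars tableStart = n * m + m
  input (i : Fin n) (k : ℕ) (hk : k < m) : s.heap (i * m + k) = wordBit (x i) k
  powers (k : ℕ) (hk : k < m) : s.heap (n * m + k) = 2 ^ k

theorem mul_add_le_mul_of_fin (i : Fin n) (m : ℕ) : i * m + m ≤ n * m := by
  simpa only [Nat.succ_mul] using Nat.mul_le_mul_right m i.2

variable {x : Fin n → BVec m} {s s' : RAMState} {p : Cmd} {i j : Fin n} {L : ℕ}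
  {D : ℕ → BVec m → BVec m}

theorem Ready.of_agree (h : Ready x s) (hv : ∀ v ∈ constantRegs, s'.vars v = s.vars v)
    (hh : ∀ a < n * m + m, s'.heap a = s.heap a) : Ready x s' where
  numVectors := (hv _ (by decide)).trans h.numVectors
  wordLength := (hv _ (by decide)).trans h.wordLength
  one := (hv _ (by decide)).trans h.one
  zero := (hv _ (by decide)).trans h.zero
  two := (hv _ (by decide)).trans h.two
  inputEnd := (hv _ (by decide)).trans h.inputEnd
  numPairs := (hv _ (by decide)).trans h.numPairs
  tableStart := (hv _ (by decide)).trans h.tableStart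
  input i k hk := by
    have := mul_add_le_mul_of_fin i m
    rw [hh _ (by omega), h.input i k hk]
  powers k hk := by rw [hh _ (by omega), h.powers k hk]

theorem Ready.of_frame (h : Ready x s) (hf : Frame p s s')
    (hv : ∀ v ∈ constantRegs, p.assigns v = false := by decide)
    (hh : p.writesHeap = false := by rfl) : Ready x s' :=
  h.of_agree (fun r hr => hf.vars_eq r (hv r hr)) fun a _ => congrFun (hf.heap_eq hh) a

theorem run_compareBitsCmd (h : Ready x s) (hl : s.vars left = i * m) (hr : s.vars right = j * m)
    {k : ℕ} (hk : k < m) (hidx : s.vars idx = k) (hd : s.vars curDist = distUpTo (x i) (x j) k)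
    (hL : n * m + m + 2 < 2 ^ L) :
    Run D L compareBitsCmd s 8 fun s' =>
      s'.vars idx = k + 1 ∧ s'.vars curDist = distUpTo (x i) (x j) (k + 1) := by
  have hi := mul_add_le_mul_of_fin i m
  have hj := mul_add_le_mul_of_fin j m
  have hdk := distUpTo_le (x i) (x j) k
  refine .step <| .add (c := i * m + k) (by rw [hl, hidx]) (by omega) <| .step <|
    .load (c := wordBit (x i) k) (by simp +decide [h.input i k hk]) <| .step <|
    .add (c := j * m + k) (by simp +decide [hr, hidx]) (by omega) <| .step <|
    .load (c := wordBit (x j) k) (by simp +decide [h.input j k hk]) ?_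
  refine .seq (N := 3) (N' := 1) (R := fun u =>
    u.vars idx = k ∧ u.vars one = 1 ∧ u.vars curDist = distUpTo (x i) (x j) (k + 1)) ?_ ?_
  · have hdiff (hne : wordBit (x i) k ≠ wordBit (x j) k) :
        distUpTo (x i) (x j) (k + 1) = distUpTo (x i) (x j) k + 1 := by
      rw [distUpTo_succ, if_neg hne]
    refine .ite (k := wordBit (x i) k) (l := wordBit (x j) k) (by simp +decide) (by simp +decide)
      (fun hlt => ?_) fun hle =>
        .ite (k := wordBit (x j) k) (l := wordBit (x i) k) (by simp +decide) (by simp +decide)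
          (fun hlt => ?_) fun hle' => ?_
    · exact .add (c := distUpTo (x i) (x j) (k + 1)) (by simp +decide [hd, h.one, hdiff hlt.ne])
        (by have := hdiff hlt.ne; omega) (by simp +decide [hidx, h.one])
    · exact .add (c := distUpTo (x i) (x j) (k + 1)) (by simp +decide [hd, h.one, hdiff hlt.ne'])
        (by have := hdiff hlt.ne'; omega) (by simp +decide [hidx, h.one])
    · exact .skip (by simp +decide [distUpTo_succ, hidx, h.one, hd, hle.antisymm hle'])
  · rintro u - ⟨huidx, hone, hu⟩
    exact .add (by rw [huidx, hone]) (by omega) (by simp +decide [hu])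

theorem run_measureCmd (h : Ready x s) (hl : s.vars left = i * m) (hr : s.vars right = j * m)
    (hL : n * m + m + 2 < 2 ^ L) :
    Run D L measureCmd s (m * 9 + 3) fun s' => s'.vars curDist = hammingDist (x i) (x j) := by
  refine .step <| .const (by omega) <| .step <| .const (by omega) ?_
  set s₀ := (s.set curDist 0).set idx 0 with hs₀
  have h₀ : Ready x s₀ := h.of_agree (by simp +decide [hs₀, constantRegs]) fun a _ => rfl
  refine (Run.forLoop m
    (fun k u => u.vars idx = k ∧ u.vars curDist = distUpTo (x i) (x j) k) ?_ ?_ ?_).imp ?_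
  · exact ⟨rfl, rfl⟩
  · rintro k u hu ⟨hidx, -⟩
    rw [hidx, (h₀.of_frame hu).wordLength]
  · rintro k u hk hu ⟨hidx, hd⟩
    exact run_compareBitsCmd (h₀.of_frame hu) ((hu.vars_eq left).trans hl)
      ((hu.vars_eq right).trans hr) hk hidx hd hL
  · rintro u - ⟨-, hd⟩
    rw [hd, distUpTo_eq_hammingDist]

theorem run_examineCmd (h : Ready x s) (hl : s.vars left = i * m) (hr : s.vars right = j * m)
    (hij : i < j) (hatt : Attained x (s.vars best) (s.vars bestLeft) (s.vars bestRight))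
    (hL : n * m + m + 2 < 2 ^ L) :
    Run D L examineCmd s (m * 9 + 7) fun s' =>
      Attained x (s'.vars best) (s'.vars bestLeft) (s'.vars bestRight) ∧
        s'.vars best ≤ s.vars best ∧ s'.vars best ≤ hammingDist (x i) (x j) := by
  have hi := mul_add_le_mul_of_fin i m
  have hj := mul_add_le_mul_of_fin j m
  refine (Run.seq (N' := 4) (run_measureCmd h hl hr hL) fun u hu hd => ?_).le (by omega)
  have hdm : hammingDist (x i) (x j) ≤ m := by
    simpa using hammingDist_le_card_fintype (x := x i) (y := x j)
  have hzero := (h.of_frame hu).zero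
  refine .ite hd (hu.vars_eq best) (fun hlt => ?_) fun hle => .skip ?_
  · refine .step <| .add (c := hammingDist (x i) (x j)) (by rw [hd, hzero, add_zero]) (by omega) <|
      .step <| .add (c := i * m) (by simp +decide [hu.vars_eq left, hl, hzero]) (by omega) <|
      .add (c := j * m) (by simp +decide [hu.vars_eq right, hr, hzero]) (by omega) ?_
    exact ⟨.inr ⟨i, j, hij, rfl, rfl, rfl⟩, hlt.le, le_rfl⟩
  · rw [hu.vars_eq best, hu.vars_eq bestLeft, hu.vars_eq bestRight]
    exact ⟨hatt, le_rfl, hle⟩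

end Examine

/-! ## Inserting an item -/

/-- Append the item in the variables `code`, `pos`, `src` to the queue. -/
def enqueueCmd : Cmd :=
  .store queueEnd code ;; .add queueEnd queueEnd one ;; .store queueEnd pos ;;
  .add queueEnd queueEnd one ;; .store queueEnd src ;; .add queueEnd queueEnd one ;;
  .add queueLength queueLength one

/-- Examine the pair of the vectors at the addresses `entry` and `src`, if these are different. -/
def collideCmd : Cmd :=
  .ite entry src (.add left entry zero ;; .add right src zero ;; examineCmd)
    (.ite src entry (.add left src zero ;; .add right entry zero ;; examineCmd) .skip)

/-- Look up the word `code` in the table. If it has not been met before, record that it has been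
reached from the vector `src`; otherwise examine this vector and the one found in the table. -/
def recordCmd : Cmd :=
  .add addr tableStart code ;; .load entry addr ;;
  .ite zero entry (.sub entry entry one ;; collideCmd) (.add entry src one ;; .store addr entry)

/-- Insert the item in the variables `code`, `pos`, `src` into the queue and into the table. -/
def insertCmd : Cmd := enqueueCmd ;; recordCmd

section Insert

variable {n m : ℕ} {x : Fin n → BVec m} {s s' : RAMState} {p : Cmd} {L : ℕ}
  {D : ℕ → BVec m → BVec m} {P : List (Item n m)} {e : Item n m}

/-- The queue holds the items in `P`, each in three consecutive cells. -/
structure Queued (P : List (Item n m)) (s : RAMState) : Prop where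
  queueEnd : s.vars queueEnd = queueBase n m + 3 * P.length
  queueLength : s.vars queueLength = P.length
  items (t : ℕ) (e : Item n m) (he : P[t]? = some e) :
    s.heap (queueBase n m + 3 * t) = wordCode e.word ∧
      s.heap (queueBase n m + 3 * t + 1) = e.pos ∧ s.heap (queueBase n m + 3 * t + 2) = e.src * m

/-- The items in `P` have been entered into the table, and the best pair takes into account all
their collisions. -/
structure Recorded (x : Fin n → BVec m) (P : List (Item n m)) (s : RAMState) : Prop where
  table (w : BVec m) : s.heap (n * m + m + wordCode w) = tableEntry P w
  attained : Attained x (s.vars best) (s.vars bestLeft) (s.vars bestRight)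
  covers : Covers x P (s.vars best)

/-- The variables `code`, `pos`, `src` hold the item `e`. -/
structure Holds (e : Item n m) (s : RAMState) : Prop where
  code : s.vars code = wordCode e.word
  pos : s.vars pos = e.pos
  src : s.vars src = e.src * m

theorem Queued.of_frame (h : Queued P s) (hf : Frame p s s')
    (hh : ∀ a, queueBase n m ≤ a → s'.heap a = s.heap a)
    (hv : ∀ v ∈ ([Reg.queueEnd, Reg.queueLength] : List ℕ), p.assigns v = false := by decide) :
    Queued P s' where
  queueEnd := (hf.vars_eq _ (hv _ (by decide))).trans h.queueEnd
  queueLength := (hf.vars_eq _ (hv _ (by decide))).trans h.queueLength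
  items t e he := by
    rw [hh _ (by omega), hh _ (by omega), hh _ (by omega)]
    exact h.items t e he

theorem Recorded.of_frame (h : Recorded x P s) (hf : Frame p s s')
    (hh : ∀ a < queueBase n m, s'.heap a = s.heap a)
    (hv : ∀ v ∈ ([best, bestLeft, bestRight] : List ℕ), p.assigns v = false := by decide) :
    Recorded x P s' := by
  have hbest := hf.vars_eq best (hv _ (by decide))
  refine ⟨fun w => ?_, ?_, by rw [hbest]; exact h.covers⟩
  · have := wordCode_lt w
    rw [hh _ (by rw [queueBase]; omega), h.table]
  · rw [hbest, hf.vars_eq bestLeft (hv _ (by decide)), hf.vars_eq bestRight (hv _ (by decide))]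
    exact h.attained

theorem Holds.of_frame (h : Holds e s) (hf : Frame p s s')
    (hv : ∀ v ∈ ([Reg.code, Reg.pos, Reg.src] : List ℕ), p.assigns v = false := by decide) :
    Holds e s' where
  code := (hf.vars_eq _ (hv _ (by decide))).trans h.code
  pos := (hf.vars_eq _ (hv _ (by decide))).trans h.pos
  src := (hf.vars_eq _ (hv _ (by decide))).trans h.src

theorem run_enqueueCmd (h : Queued P s) (he : Holds e s) (hone : s.vars one = 1)
    (hL : queueBase n m + 3 * (P.length + 1) + 2 < 2 ^ L) :
    Run D L enqueueCmd s 7 fun s' =>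
      Queued (P ++ [e]) s' ∧ ∀ a < queueBase n m, s'.heap a = s.heap a := by
  set q := queueBase n m + 3 * P.length with hq
  refine .step <| .store h.queueEnd he.code <| .step <|
    .add (c := q + 1) (by simp +decide [hone, h.queueEnd, hq]) (by omega) <| .step <|
    .store (k := q + 1) (c := e.pos) (by simp +decide) (by simp +decide [he.pos]) <| .step <|
    .add (c := q + 2) (by simp +decide [hone]) (by omega) <| .step <|
    .store (k := q + 2) (c := e.src * m) (by simp +decide) (by simp +decide [he.src]) <| .step <|
    .add (c := q + 3) (by simp +decide [hone]) (by omega) <|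
    .add (c := P.length + 1) (by simp +decide [hone, h.queueLength]) (by omega) ?_
  refine ⟨⟨by simp +decide [hq, mul_add, add_assoc], by simp +decide,
    fun t f hf => ?_⟩, fun a ha => ?_⟩
  · have ht : t < (P ++ [e]).length := (List.getElem?_eq_some_iff.1 hf).1
    rw [List.length_append, List.length_singleton] at ht
    rcases (Nat.lt_succ_iff.1 ht).lt_or_eq with ht | rfl
    · rw [List.getElem?_append_left ht] at hf
      have := h.items t f hf
      simpa (disch := omega) [if_neg]
    · obtain rfl : e = f := by simpa using hf
      simp [hq]
  · simp (disch := omega) [if_neg]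

theorem run_collideCmd (hm : 1 ≤ m) (h : Ready x s) {a b : Fin n} (hentry : s.vars entry = a * m)
    (hsrc : s.vars src = b * m)
    (hatt : Attained x (s.vars best) (s.vars bestLeft) (s.vars bestRight))
    (hL : n * m + m + 2 < 2 ^ L) :
    Run D L collideCmd s (m * 9 + 11) fun s' =>
      Attained x (s'.vars best) (s'.vars bestLeft) (s'.vars bestRight) ∧
        s'.vars best ≤ s.vars best ∧ (a ≠ b → s'.vars best ≤ hammingDist (x a) (x b)) := by
  have ha := mul_add_le_mul_of_fin a m
  have hb := mul_add_le_mul_of_fin b m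
  refine .ite hentry hsrc (fun hlt => ?_) fun hle => .ite hsrc hentry (fun hlt => ?_) fun hle' => ?_
  · have hab : a < b := Fin.lt_def.2 (lt_of_mul_lt_mul_right hlt (Nat.zero_le m))
    refine Run.le (L := L) (N := m * 9 + 9) (.step <|
      .add (c := a * m) (by rw [hentry, h.zero, add_zero]) (by omega) <| .step <|
      .add (c := b * m) (by simp +decide [hsrc, h.zero]) (by omega) ?_) (by omega)
    refine Run.imp (run_examineCmd (h.of_agree (by simp +decide [constantRegs]) fun _ _ => rfl)
      rfl rfl hab hatt hL) ?_
    exact fun s' _ ⟨hatt', hle, hdist⟩ => ⟨hatt', hle, fun _ => hdist⟩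
  · have hba : b < a := Fin.lt_def.2 (lt_of_mul_lt_mul_right hlt (Nat.zero_le m))
    refine .step <| .add (c := b * m) (by rw [hsrc, h.zero, add_zero]) (by omega) <| .step <|
      .add (c := a * m) (by simp +decide [hentry, h.zero]) (by omega) ?_
    refine Run.imp (run_examineCmd (h.of_agree (by simp +decide [constantRegs]) fun _ _ => rfl)
      rfl rfl hba hatt hL) ?_
    exact fun s' _ ⟨hatt', hle, hdist⟩ => ⟨hatt', hle, fun _ => hammingDist_comm (x b) _ ▸ hdist⟩
  · exact .skip ⟨hatt, le_rfl, fun hab =>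
      absurd (Fin.ext (Nat.eq_of_mul_eq_mul_right hm (hle'.antisymm hle))) hab⟩

theorem run_recordCmd (hm : 1 ≤ m) (h : Ready x s) (hP : Recorded x P s) (he : Holds e s)
    (hL : queueBase n m + 2 < 2 ^ L) :
    Run D L recordCmd s (m * 9 + 15) fun s' => Recorded x (P ++ [e]) s' ∧
      ∀ a, a < n * m + m ∨ queueBase n m ≤ a → s'.heap a = s.heap a := by
  have hcode := wordCode_lt e.word
  have hsrc := mul_add_le_mul_of_fin e.src m
  rw [queueBase] at hL ⊢
  refine .step <| .add (c := n * m + m + wordCode e.word) (by rw [h.tableStart, he.code]) (by omega)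
    <| .step <| .load (c := tableEntry P e.word) (by simp +decide [hP.table]) ?_
  refine .ite (k := 0) (l := tableEntry P e.word) (by simp +decide [h.zero]) rfl
    (fun hlt => ?_) fun hle => ?_
  · rcases hs : firstSource P e.word with _ | a
    · exact absurd (tableEntry_of_firstSource_none hs) hlt.ne'
    refine .step <| .sub (c := a * m)
      (by simp +decide [tableEntry_of_firstSource hs, h.one]) ?_
    refine Run.imp (run_collideCmd (x := x) (a := a) (b := e.src) hm ?_ ?_ ?_ ?_ (by omega)) ?_
    · exact h.of_agree (by simp +decide [constantRegs]) fun _ _ => rfl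
    · simp +decide
    · simp +decide [he.src]
    · exact hP.attained
    rintro s' hf ⟨hatt, hle, hdist⟩
    refine ⟨⟨fun w => ?_, hatt, ?_⟩, fun a _ => congrFun (hf.heap_eq) a⟩
    · rw [hf.heap_eq, tableEntry_append_of_firstSource hs]
      exact hP.table w
    · refine (hP.covers.mono hle).append_singleton fun s hs' hne => ?_
      obtain rfl : a = s := Option.some_injective _ (hs.symm.trans hs')
      exact hdist hne
  · rcases hs : firstSource P e.word with _ | a
    · refine Run.le (D := D) (L := L) (N := 2) (.step <| .add (c := e.src * m + 1)
        (by simp +decide [he.src, h.one]) (by omega) <|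
        .store (k := n * m + m + wordCode e.word) (c := e.src * m + 1) (by simp +decide)
          (by simp +decide) ?_) (by omega)
      refine ⟨⟨fun w => ?_, hP.attained, ?_⟩, fun a ha => ?_⟩
      · simp [tableEntry_append_of_firstSource_none hs, wordCode_injective.eq_iff, hP.table]
      · exact hP.covers.append_singleton fun s hs' => by simp [hs] at hs'
      · simp (disch := omega) [if_neg]
    · rw [tableEntry_of_firstSource hs] at hle
      omega

/-- The state of the memory after the items in `P` have been inserted. -/
structure SearchState (x : Fin n → BVec m) (P : List (Item n m)) (s : RAMState) : Prop extends
    Ready x s, Queued P s, Recorded x P s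

theorem SearchState.of_frame (h : SearchState x P s) (hf : Frame p s s')
    (hv : ∀ v ∈ constantRegs ++
      ([Reg.queueEnd, Reg.queueLength, best, bestLeft, bestRight] : List ℕ),
      p.assigns v = false := by decide)
    (hh : p.writesHeap = false := by rfl) : SearchState x P s' where
  toReady := h.toReady.of_frame hf (fun v hv' => hv v (List.mem_append_left _ hv')) hh
  toQueued := h.toQueued.of_frame hf (fun _ _ => by rw [hf.heap_eq hh]) fun v hv' => hv v (by
    revert v; decide)
  toRecorded := h.toRecorded.of_frame hf (fun _ _ => by rw [hf.heap_eq hh]) fun v hv' => hv v (by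
    revert v; decide)

theorem run_insertCmd (hm : 1 ≤ m) (h : SearchState x P s) (he : Holds e s)
    (hL : queueBase n m + 3 * (P.length + 1) + 2 < 2 ^ L) :
    Run D L insertCmd s (m * 9 + 22) (SearchState x (P ++ [e])) := by
  refine (Run.seq (run_enqueueCmd h.toQueued he h.one hL) fun u hu ⟨hqueue, hheap⟩ => ?_).le
    (by omega : 7 + (m * 9 + 15) ≤ _)
  have hready : Ready x u := h.toReady.of_agree (fun v hv => hu.vars_eq v (by revert v; decide))
    fun a ha => hheap a (ha.trans_le (Nat.le_add_right _ _))
  refine (run_recordCmd hm hready (h.toRecorded.of_frame hu hheap) (he.of_frame hu)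
    (by omega)).imp fun s' hs' ⟨hrec, hheap'⟩ => ⟨?_, ?_, hrec⟩
  · exact hready.of_agree (fun v hv => hs'.vars_eq v (by revert v; decide))
      fun a ha => hheap' a (.inl ha)
  · exact hqueue.of_frame hs' fun a ha => hheap' a (.inr ha)

end Insert

/-! ## Generating the next level -/

/-- Compute the number of the word that arises from the word with the number `parent` by flipping
the bit `pos`, provided that this bit agrees with that of the vector at the address `src`. -/
def flipCmd : Cmd :=
  .add addr src pos ;; .load bit addr ;; .add addr inputEnd pos ;; .load power addr ;;
  .ite zero bit (.sub code parent power) (.add code parent power)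

/-- Insert the child of an item in which the bit `pos` is flipped. -/
def childCmd : Cmd := flipCmd ;; .add pos pos one ;; insertCmd

/-- Insert the children of the item in the variables `parent`, `pos`, `src`. -/
def childrenCmd : Cmd := .loop pos wordLength childCmd

/-- Fetch the next item from the queue. -/
def fetchCmd : Cmd :=
  .load parent head ;; .add head head one ;; .load pos head ;; .add head head one ;;
  .load src head ;; .add head head one

/-- Insert the children of the next item in the queue. -/
def expandCmd : Cmd := fetchCmd ;; childrenCmd

/-- Insert the children of all the items from the address `head` to the present end of the queue. -/
def levelCmd : Cmd := .add levelEnd queueEnd zero ;; .loop head levelEnd expandCmd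

section Level

variable {n m : ℕ} {x : Fin n → BVec m} {s : RAMState} {L l : ℕ} {D : ℕ → BVec m → BVec m}
  {P : List (Item n m)} {e : Item n m}

theorem run_flipCmd (h : Ready x s) (he : e.Valid x l) (hparent : s.vars parent = wordCode e.word)
    (hsrc : s.vars src = e.src * m) {k : ℕ} (hk : e.pos ≤ k) (hkm : k < m) (hpos : s.vars pos = k)
    (hL : queueBase n m < 2 ^ L) :
    Run D L flipCmd s 6 fun s' => s'.vars code = wordCode (flipBit e.word k) := by
  have hsrc_le := mul_add_le_mul_of_fin e.src m
  have hcode := wordCode_lt (flipBit e.word k)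
  rw [queueBase] at hL
  refine .step <| .add (c := e.src * m + k) (by rw [hsrc, hpos]) (by omega) <| .step <|
    .load (c := wordBit e.word k)
      (by simp +decide [h.input e.src k hkm, he.agree k hk]) <| .step <|
    .add (c := n * m + k) (by simp +decide [h.inputEnd, hpos]) (by omega) <| .step <|
    .load (c := 2 ^ k) (by simp +decide [h.powers k hkm]) ?_
  rw [wordCode_flipBit e.word hkm] at hcode ⊢
  refine .ite (k := 0) (l := wordBit e.word k) (by simp +decide [h.zero]) (by simp +decide)
    (fun hbit => ?_) fun hbit => ?_
  · rw [if_pos hbit]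
    exact .sub (c := wordCode e.word - 2 ^ k) (by simp +decide [hparent]) (by simp)
  · rw [if_neg hbit.not_gt] at hcode ⊢
    exact .add (c := wordCode e.word + 2 ^ k) (by simp +decide [hparent]) (by omega) (by simp)

theorem run_childCmd (hm : 1 ≤ m) (h : SearchState x P s) (he : e.Valid x l)
    (hparent : s.vars parent = wordCode e.word) (hsrc : s.vars src = e.src * m) {k : ℕ}
    (hk : e.pos ≤ k) (hkm : k < m) (hpos : s.vars pos = k)
    (hL : queueBase n m + 3 * (P.length + 1) + 2 < 2 ^ L) :
    Run D L childCmd s (m * 9 + 29) fun s' =>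
      s'.vars pos = k + 1 ∧ SearchState x (P ++ [e.child k]) s' := by
  refine (Run.seq (run_flipCmd h.toReady he hparent hsrc hk hkm hpos (by omega))
    fun u hu hcode => Run.seq (N := 1) (R := fun u => u.vars pos = k + 1) ?_
      fun w hw hpos' => ?_).le (by omega : 6 + (1 + (m * 9 + 22)) ≤ _)
  · have hone := (h.of_frame hu).one
    refine .add (c := k + 1) (by rw [hu.vars_eq pos, hpos, hone]) ?_ (by simp)
    have := Nat.two_pow_pos m
    rw [queueBase] at hL
    omega
  · refine (run_insertCmd hm ((h.of_frame hu).of_frame hw) ⟨?_, hpos', ?_⟩ hL).imp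
      fun s' hs' h' => ⟨(hs'.vars_eq pos).trans hpos', h'⟩
    · rw [hw.vars_eq code, hcode, Item.child]
    · rw [hw.vars_eq src, hu.vars_eq src, hsrc, Item.child]

theorem run_childrenCmd (hm : 1 ≤ m) (h : SearchState x P s) (he : e.Valid x l)
    (hparent : s.vars parent = wordCode e.word) (hpos : s.vars pos = e.pos)
    (hsrc : s.vars src = e.src * m)
    (hL : queueBase n m + 3 * (P.length + e.children.length) + 2 < 2 ^ L) :
    Run D L childrenCmd s (m * (m * 9 + 30) + 1) (SearchState x (P ++ e.children)) := by
  have hpos_le := he.pos_le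
  refine ((Run.forLoop (m - e.pos) (fun k u => u.vars pos = e.pos + k ∧
    SearchState x (P ++ (List.range' e.pos k).map e.child) u) ?_ ?_ ?_).imp ?_).le
      (Nat.succ_le_succ (Nat.mul_le_mul_right (m * 9 + 30) (Nat.sub_le m e.pos)))
  · exact ⟨hpos, by simpa using h⟩
  · rintro k u - ⟨hupos, hstate⟩
    rw [hupos, hstate.wordLength]
    omega
  · rintro k u hk hu ⟨hupos, hstate⟩
    refine (run_childCmd hm hstate he ((hu.vars_eq parent).trans hparent)
      ((hu.vars_eq src).trans hsrc) (Nat.le_add_right _ k) (by omega) hupos ?_).imp ?_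
    · simp only [List.length_append, List.length_map, List.length_range', Item.children] at hL ⊢
      omega
    · rintro s' - ⟨hpos', hstate'⟩
      refine ⟨hpos', ?_⟩
      rwa [List.range'_1_concat, List.map_append, ← List.append_assoc]
  · exact fun s' _ h' => h'.2

theorem run_fetchCmd (h : SearchState x P s) {t : ℕ} (he : P[t]? = some e)
    (hhead : s.vars head = queueBase n m + 3 * t)
    (hL : queueBase n m + 3 * P.length < 2 ^ L) :
    Run D L fetchCmd s 6 fun s' => s'.vars parent = wordCode e.word ∧ s'.vars pos = e.pos ∧
      s'.vars src = e.src * m ∧ s'.vars head = queueBase n m + 3 * (t + 1) := by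
  obtain ⟨hword, hpos, hsrc⟩ := h.items t e he
  have ht : t < P.length := (List.getElem?_eq_some_iff.1 he).1
  set a := queueBase n m + 3 * t with ha
  refine .step <| .load (by rw [hhead, hword]) <| .step <|
    .add (c := a + 1) (by simp +decide [hhead, h.one]) (by omega) <| .step <|
    .load (c := e.pos) (by simp +decide [hpos]) <| .step <|
    .add (c := a + 2) (by simp +decide [h.one]) (by omega) <| .step <|
    .load (c := e.src * m) (by simp +decide [hsrc]) <|
    .add (c := a + 3) (by simp +decide [h.one]) (by omega) ?_
  simp +decide [ha, mul_add, add_assoc]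

theorem run_expandCmd (hm : 1 ≤ m) (h : SearchState x P s) {t : ℕ} (het : P[t]? = some e)
    (he : e.Valid x l) (hhead : s.vars head = queueBase n m + 3 * t)
    (hL : queueBase n m + 3 * (P.length + e.children.length) + 2 < 2 ^ L) :
    Run D L expandCmd s (m * (m * 9 + 30) + 7) fun s' =>
      SearchState x (P ++ e.children) s' ∧ s'.vars head = queueBase n m + 3 * (t + 1) :=
  (Run.seq (run_fetchCmd h het hhead (by omega)) fun u hu ⟨hparent, hpos, hsrc, hhead'⟩ =>
    (run_childrenCmd hm (h.of_frame hu) he hparent hpos hsrc hL).imp fun s' hs' hstate =>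
      ⟨hstate, (hs'.vars_eq head).trans hhead'⟩).le
    (by omega : 6 + (m * (m * 9 + 30) + 1) ≤ _)

theorem run_levelCmd (hm : 1 ≤ m) {A B : List (Item n m)} (h : SearchState x (A ++ B) s)
    (hB : ∀ e ∈ B, e.Valid x l) (hhead : s.vars head = queueBase n m + 3 * A.length)
    (hL : queueBase n m + 3 * (A ++ B ++ B.flatMap Item.children).length + 2 < 2 ^ L) :
    Run D L levelCmd s (B.length * (m * (m * 9 + 30) + 8) + 2) fun s' =>
      SearchState x (A ++ B ++ B.flatMap Item.children) s' ∧
        s'.vars head = queueBase n m + 3 * (A ++ B).length := by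
  set children : ℕ → List (Item n m) := fun q => (B.take q).flatMap Item.children
  refine (Run.seq (N := 1) (R := fun u => u.vars levelEnd = queueBase n m + 3 * (A ++ B).length)
    (.add (c := queueBase n m + 3 * (A ++ B).length) ?_ ?_ (by simp)) fun u hu hend =>
      (Run.forLoop (N := m * (m * 9 + 30) + 7) B.length
        (fun q w => SearchState x (A ++ B ++ children q) w ∧
          w.vars head = queueBase n m + 3 * (A.length + q)) ?_ ?_ ?_).imp ?_).le
      (Nat.add_comm 1 _).le
  · rw [h.queueEnd, h.zero, add_zero]
  · simp only [List.length_append] at hL ⊢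
    omega
  · exact ⟨by simpa [children] using h.of_frame hu, (hu.vars_eq head).trans hhead⟩
  · rintro q w hw ⟨-, hwhead⟩
    rw [hwhead, hw.vars_eq levelEnd, hend, List.length_append]
    omega
  · rintro q w hq - ⟨hstate, hwhead⟩
    have hget : (A ++ B ++ children q)[A.length + q]? = some B[q] := by
      simp [List.getElem?_append, hq]
    have hnext : children (q + 1) = children q ++ B[q].children := by
      simp only [children, List.take_succ_eq_append_getElem hq, List.flatMap_append,
        List.flatMap_singleton]
    have hle := ((List.take_sublist (q + 1) B).flatMap Item.children).length_le
    change (children (q + 1)).length ≤ _ at hle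
    rw [hnext, List.length_append] at hle
    simp only [List.length_append] at hL
    rw [hnext, ← List.append_assoc]
    exact run_expandCmd hm hstate hget (hB _ (List.getElem_mem hq)) hwhead
      (by simp only [List.length_append]; omega)
  · rintro s' - ⟨hstate, hhead'⟩
    simp only [children, List.take_length] at hstate
    exact ⟨hstate, by rw [hhead', List.length_append]⟩

end Level

/-! ## The search -/

/-- Set the bound for the diameter: the best distance, or `0` if the queue is too long. -/
def limitCmd : Cmd := .ite queueLength numPairs (.add limit best zero) (.const limit 0)

/-- Search the balls with the next larger radius. -/
def widenCmd : Cmd := levelCmd ;; .add diameter diameter two ;; limitCmd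

/-- Search in larger and larger balls, until the diameter `2 * ρ` is at least the best distance or
the queue has at least `n ^ 2` items. -/
def searchCmd : Cmd := .const diameter 0 ;; limitCmd ;; .loop diameter limit widenCmd

/-- Examine the pairs of the vector at the address `left` with all those behind it. -/
def rowCmd : Cmd :=
  .add right left wordLength ;;
  .loop right inputEnd (examineCmd ;; .add right right wordLength)

/-- Examine all pairs of vectors. -/
def allPairsCmd : Cmd :=
  .const left 0 ;; .loop left inputEnd (rowCmd ;; .add left left wordLength)

section Search

variable {n m : ℕ} {x : Fin n → BVec m} {s : RAMState} {L ρ : ℕ} {D : ℕ → BVec m → BVec m}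
  {P : List (Item n m)} {i j : Fin n}

theorem Attained.le_succ {b a a' : ℕ} (h : Attained x b a a') : b ≤ m + 1 := by
  rcases h with rfl | ⟨k, l, -, -, -, rfl⟩
  · exact le_rfl
  · exact (hammingDist_le_card_fintype.trans_eq (Fintype.card_fin m)).trans m.le_succ

theorem run_limitCmd (h : SearchState x P s) (hL : m + 1 < 2 ^ L) :
    Run D L limitCmd s 2 fun s' =>
      s'.vars limit = if P.length < n * n then s.vars best else 0 := by
  refine .ite h.queueLength h.numPairs (fun hlt => ?_) fun hle => ?_
  · exact .add (by rw [h.zero, add_zero]) (h.attained.le_succ.trans_lt hL) (by simp [hlt])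
  · exact .const (by omega) (by simp [hle])

theorem exists_searchUpTo_eq_append (x : Fin n → BVec m) (ρ : ℕ) :
    ∃ A, searchUpTo x ρ = A ++ searchLevel x ρ := by
  cases ρ with
  | zero => exact ⟨[], rfl⟩
  | succ ρ => exact ⟨searchUpTo x ρ, rfl⟩

theorem length_searchLevel_le {K : ℕ} (x : Fin n → BVec m) (h : ballCard m ρ ≤ n) (hρ : ρ ≤ K) :
    (searchLevel x ρ).length ≤ n * min n (ballCard m K) := by
  have hchoose : m.choose ρ ≤ ballCard m ρ :=
    Finset.single_le_sum (f := fun l => m.choose l) (fun _ _ => Nat.zero_le _)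
      (Finset.self_mem_range_succ ρ)
  rw [length_searchLevel]
  exact Nat.mul_le_mul_left n (le_min (hchoose.trans h) (hchoose.trans (ballCard_mono m hρ)))

/-- The invariant of the search, after the levels up to `ρ`. -/
structure SearchInv (x : Fin n → BVec m) (ρ : ℕ) (s : RAMState) : Prop where
  state : SearchState x (searchUpTo x ρ) s
  diameter : s.vars diameter = 2 * ρ
  limit : s.vars limit = if (searchUpTo x ρ).length < n * n then s.vars best else 0
  head : s.vars head + 3 * (searchLevel x ρ).length = queueBase n m + 3 * (searchUpTo x ρ).length

theorem run_widenCmd (hm : 1 ≤ m) (h : SearchInv x ρ s) (hρ : ρ ≤ m)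
    (hL : queueBase n m + 3 * (n * 2 ^ m) + 2 < 2 ^ L) :
    Run D L widenCmd s ((searchLevel x ρ).length * (m * (m * 9 + 30) + 8) + 5)
      (SearchInv x (ρ + 1)) := by
  obtain ⟨A, hA⟩ := exists_searchUpTo_eq_append x ρ
  obtain ⟨hstate, hdiameter, -, hhead⟩ := h
  have hm2 : m < 2 ^ m := Nat.lt_two_pow_self
  have hlen : (searchUpTo x (ρ + 1)).length ≤ n * 2 ^ m := by
    rw [length_searchUpTo]
    exact Nat.mul_le_mul_left n (ballCard_le_two_pow m _)
  rw [searchUpTo, searchLevel, hA] at hlen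
  rw [hA] at hstate hhead
  rw [List.length_append] at hhead
  have hqueue : queueBase n m = n * m + m + 2 ^ m := rfl
  refine (Run.seq (run_levelCmd hm hstate (fun e => valid_of_mem_searchLevel) (by omega) (by omega))
    fun u hu ⟨hustate, huhead⟩ => Run.seq (N := 1) (N' := 2)
      (R := fun u => u.vars diameter = 2 * (ρ + 1)) (.add (c := 2 * (ρ + 1)) ?_ (by omega)
        (by simp)) fun v hv hvdiameter => ?_).le (Nat.add_assoc _ 2 3).le
  · rw [hu.vars_eq diameter, hdiameter, hustate.two, mul_add, mul_one]
  · rw [← hA] at hustate huhead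
    have hvstate : SearchState x (searchUpTo x (ρ + 1)) v := hustate.of_frame hv
    refine (run_limitCmd hvstate (by omega)).imp fun s' hs' hlimit =>
      ⟨hvstate.of_frame hs', (hs'.vars_eq diameter).trans hvdiameter, ?_, ?_⟩
    · rw [hlimit, hs'.vars_eq best]
    · rw [hs'.vars_eq head, hv.vars_eq head, huhead, searchUpTo, List.length_append]
      omega

theorem run_searchCmd (hm : 1 ≤ m) (hx : IsUniqueClosestPair x i j)
    (h : SearchState x (searchUpTo x 0) s) (hhead : s.vars head = queueBase n m)
    (hL : queueBase n m + 3 * (n * 2 ^ m) + 2 < 2 ^ L) {K : ℕ}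
    (hK : K = (hammingDist (x i) (x j) + 1) / 2) :
    Run D L searchCmd s
      (K * (n * min n (ballCard m K) * (m * (m * 9 + 30) + 8) + 6) + 4)
      fun s' => ∃ ρ ≤ K, SearchInv x ρ s' ∧ s'.vars limit ≤ 2 * ρ := by
  have hdm : hammingDist (x i) (x j) ≤ m :=
    hammingDist_le_card_fintype.trans_eq (Fintype.card_fin m)
  have hm2 : m < 2 ^ m := Nat.lt_two_pow_self
  have hqueue : queueBase n m = n * m + m + 2 ^ m := rfl
  refine Run.le (Run.seq (N := 1) (N' := _) (R := fun u => u.vars diameter = 0)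
    (.const (by omega) (by simp)) fun u hu hdiameter => Run.seq (run_limitCmd (h.of_frame hu)
      (by omega)) fun v hv hlimit => (Run.loop (SearchInv x) K.zero_le ?_ ?_).imp ?_)
    (N := 1 + (2 + ((K - 0) * (n * min n (ballCard m K) * (m * (m * 9 + 30) + 8) + 5 + 1) + 1)))
    (by rw [Nat.sub_zero]; exact le_of_eq (by ring))
  · refine ⟨(h.of_frame hu).of_frame hv, (hv.vars_eq diameter).trans hdiameter, ?_, ?_⟩
    · rw [hlimit, hv.vars_eq best]
    · rw [hv.vars_eq head, hu.vars_eq head, hhead, searchUpTo]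
  · rintro ρ w - hw hlt
    have hcount : (searchUpTo x ρ).length < n * n := by
      by_contra hcount
      simp [hw.limit, hcount] at hlt
    rw [hw.diameter, hw.limit, if_pos hcount] at hlt
    have hρK : ρ < K := by
      by_contra hρK
      exact hlt.not_ge ((hw.state.covers.le_hammingDist hx (by omega)).trans (by omega))
    rw [length_searchUpTo] at hcount
    refine ⟨hρK, (run_widenCmd hm hw (by omega) hL).le ?_⟩
    gcongr
    exact length_searchLevel_le x (lt_of_mul_lt_mul_left hcount n.zero_le).le hρK.le
  · rintro s' - ⟨ρ, hρ, hs', hle⟩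
    exact ⟨ρ, hρ, hs', hle.trans_eq hs'.diameter⟩

theorem run_rowCmd (hm : 1 ≤ m) (h : Ready x s) {i : Fin n} (hleft : s.vars left = i * m)
    (hatt : Attained x (s.vars best) (s.vars bestLeft) (s.vars bestRight))
    (hL : n * m + m + 2 < 2 ^ L) :
    Run D L rowCmd s (n * (m * 9 + 9) + 2) fun s' =>
      Attained x (s'.vars best) (s'.vars bestLeft) (s'.vars bestRight) ∧
        s'.vars best ≤ s.vars best ∧ ∀ j, i < j → s'.vars best ≤ hammingDist (x i) (x j) := by
  have hi := mul_add_le_mul_of_fin i m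
  refine Run.step <| .add (c := (i + 1) * m) (by rw [hleft, h.wordLength, Nat.succ_mul])
    (by rw [Nat.succ_mul]; omega) ?_
  have h₀ : Ready x (s.set right ((i + 1) * m)) :=
    h.of_agree (by simp +decide [constantRegs]) fun _ _ => rfl
  refine ((Run.forLoop (n - (i + 1)) (fun k u => u.vars right = (i + 1 + k) * m ∧
    Attained x (u.vars best) (u.vars bestLeft) (u.vars bestRight) ∧ u.vars best ≤ s.vars best ∧
    ∀ j, i < j → (j : ℕ) < i + 1 + k → u.vars best ≤ hammingDist (x i) (x j)) ?_ ?_ ?_).imp ?_).le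
      (Nat.succ_le_succ (Nat.mul_le_mul_right (m * 9 + 9) (Nat.sub_le n (i + 1))))
  · exact ⟨by simp, hatt, le_rfl, fun j hij hj => absurd hj (by omega)⟩
  · rintro k u hu ⟨hright, -⟩
    rw [hright, (h₀.of_frame hu).inputEnd, Nat.mul_lt_mul_right hm]
    omega
  · rintro k u hk hu ⟨hright, huatt, hle, hrow⟩
    have hu₀ : Ready x u := h₀.of_frame hu
    set j : Fin n := ⟨i + 1 + k, by omega⟩ with hj
    have hj' := mul_add_le_mul_of_fin j m
    refine Run.seq (N' := 1) (run_examineCmd (j := j) hu₀ ((hu.vars_eq left).trans hleft) hright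
      (Fin.lt_def.2 (by rw [hj]; simp only; omega)) huatt hL) fun v hv ⟨hvatt, hvle, hdist⟩ => ?_
    refine .add (c := j * m + m) ?_ (by omega) ⟨?_, hvatt, hvle.trans hle, fun j' hij' hj'' => ?_⟩
    · rw [hv.vars_eq right, hright, (hu₀.of_frame hv).wordLength]
    · simp [hj, Nat.succ_mul, ← add_assoc]
    · rcases (Nat.lt_succ_iff.1 hj'').lt_or_eq with hlt | heq
      · exact hvle.trans (hrow j' hij' hlt)
      · exact (Fin.ext heq : j' = j) ▸ hdist
  · rintro s' - ⟨-, hatt', hle, hrow⟩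
    exact ⟨hatt', hle, fun j hij => hrow j hij (by omega)⟩

theorem run_allPairsCmd (hm : 1 ≤ m) (h : Ready x s)
    (hatt : Attained x (s.vars best) (s.vars bestLeft) (s.vars bestRight))
    (hL : n * m + m + 2 < 2 ^ L) :
    Run D L allPairsCmd s (n * (n * (m * 9 + 9) + 4) + 2) fun s' =>
      Attained x (s'.vars best) (s'.vars bestLeft) (s'.vars bestRight) ∧
        ∀ i j, i < j → s'.vars best ≤ hammingDist (x i) (x j) := by
  refine Run.step <| .const (by omega) ?_
  have h₀ : Ready x (s.set left 0) := h.of_agree (by simp +decide [constantRegs]) fun _ _ => rfl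
  refine (Run.forLoop n (fun k u => u.vars left = k * m ∧
    Attained x (u.vars best) (u.vars bestLeft) (u.vars bestRight) ∧
    ∀ i j : Fin n, i < j → (i : ℕ) < k → u.vars best ≤ hammingDist (x i) (x j)) ?_ ?_ ?_).imp ?_
  · exact ⟨by simp, hatt, fun i j _ hi => absurd hi i.1.not_lt_zero⟩
  · rintro k u hu ⟨hleft, -⟩
    rw [hleft, (h₀.of_frame hu).inputEnd, Nat.mul_lt_mul_right hm]
  · rintro k u hk hu ⟨hleft, huatt, hrows⟩
    have hu₀ : Ready x u := h₀.of_frame hu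
    have hk' : k * m + m ≤ n * m := mul_add_le_mul_of_fin ⟨k, hk⟩ m
    refine Run.seq (N' := 1) (run_rowCmd (i := ⟨k, hk⟩) hm hu₀ hleft huatt hL)
      fun v hv ⟨hvatt, hvle, hrow⟩ => ?_
    refine .add (c := k * m + m) ?_ (by omega) ⟨?_, hvatt, fun i j hij hi => ?_⟩
    · rw [hv.vars_eq left, hleft, (hu₀.of_frame hv).wordLength]
    · simp [Nat.succ_mul]
    · rcases (Nat.lt_succ_iff.1 hi).lt_or_eq with hlt | rfl
      · exact hvle.trans (hrows i j hij hlt)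
      · exact hrow j hij
  · rintro s' - ⟨-, hatt', hrows⟩
    exact ⟨hatt', fun i j hij => hrows i j hij i.2⟩

end Search

/-! ## Preparation and output -/

/-- Compute the constants and products. -/
def constantsCmd : Cmd :=
  .const one 1 ;; .const two 2 ;;
  .loop counter numVectors
    (.add inputEnd inputEnd wordLength ;; .add numPairs numPairs numVectors ;;
      .add counter counter one)

/-- Write the powers of two behind the vectors. -/
def powersCmd : Cmd :=
  .const power 1 ;; .add tableStart inputEnd zero ;;
  .loop pos wordLength
    (.store tableStart power ;; .add power power power ;; .add tableStart tableStart one ;;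
      .add pos pos one)

/-- Initialize the queue, the table and the best pair. -/
def startCmd : Cmd :=
  constantsCmd ;; powersCmd ;; .add queueEnd tableStart power ;; .add head queueEnd zero ;;
  .add best wordLength one

/-- Add the next digit to the number of the vector at the address `src`. -/
def digitCmd : Cmd :=
  .add addr src pos ;; .load bit addr ;;
  .ite zero bit (.add addr inputEnd pos ;; .load power addr ;; .add code code power) .skip ;;
  .add pos pos one

/-- Compute the number of the vector at the address `src`. -/
def codeCmd : Cmd := .const code 0 ;; .const pos 0 ;; .loop pos wordLength digitCmd

/-- Insert the vector at the address `src`. -/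
def sourceCmd : Cmd := codeCmd ;; .const pos 0 ;; insertCmd

/-- Insert all the vectors. -/
def sourcesCmd : Cmd := .loop src inputEnd (sourceCmd ;; .add src src wordLength)

/-- Divide the variable `src` by the word length. -/
def divCmd : Cmd :=
  .const quotient 0 ;; .const counter 0 ;;
  .loop counter src (.add counter counter wordLength ;; .add quotient quotient one)

/-- Convert the addresses of the best pair to indices. -/
def outputCmd : Cmd :=
  .add src bestLeft zero ;; divCmd ;; .add numVectors quotient zero ;;
  .add src bestRight zero ;; divCmd ;; .add wordLength quotient zero

section Preparation

variable {n m : ℕ} {x : Fin n → BVec m} {s : RAMState} {L : ℕ} {D : ℕ → BVec m → BVec m}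

theorem run_constantsCmd (hn : s.vars numVectors = n) (hm : s.vars wordLength = m)
    (hzero : ∀ v ∈ ([inputEnd, numPairs, counter] : List ℕ), s.vars v = 0)
    (hL : n * m + n * n + n + 2 < 2 ^ L) :
    Run D L constantsCmd s (n * 4 + 3) fun s' => s'.vars one = 1 ∧ s'.vars two = 2 ∧
      s'.vars inputEnd = n * m ∧ s'.vars numPairs = n * n := by
  have hinputEnd := hzero inputEnd (by decide)
  have hnumPairs := hzero numPairs (by decide)
  have hcounter := hzero counter (by decide)
  refine .step <| .const (by omega) <| .step <| .const (by omega) ?_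
  refine (Run.forLoop n (fun k u => (u.vars one = 1 ∧ u.vars two = 2) ∧ u.vars counter = k ∧
    u.vars inputEnd = k * m ∧ u.vars numPairs = k * n) ?_ ?_ ?_).imp ?_
  · simp +decide [hinputEnd, hnumPairs, hcounter]
  · rintro k u hu ⟨-, hk, -⟩
    rw [hk, hu.vars_eq numVectors]
    simp +decide [hn]
  · rintro k u hk hu ⟨⟨hone, htwo⟩, hucounter, huinput, hupairs⟩
    have hun : u.vars numVectors = n := by simp +decide [hu.vars_eq numVectors, hn]
    have hum : u.vars wordLength = m := by simp +decide [hu.vars_eq wordLength, hm]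
    have hkm : k * m + m ≤ n * m := mul_add_le_mul_of_fin ⟨k, hk⟩ m
    have hkn : k * n + n ≤ n * n := mul_add_le_mul_of_fin ⟨k, hk⟩ n
    refine .step <| .add (c := k * m + m) (by rw [huinput, hum]) (by omega) <| .step <|
      .add (c := k * n + n) (by simp +decide [hupairs, hun]) (by omega) <|
      .add (c := k + 1) (by simp +decide [hucounter, hone]) (by omega) ?_
    simp +decide [hone, htwo, Nat.succ_mul]
  · exact fun s' _ ⟨⟨hone, htwo⟩, _, hinput, hpairs⟩ => ⟨hone, htwo, hinput, hpairs⟩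

theorem run_powersCmd (hm : s.vars wordLength = m) (hone : s.vars one = 1)
    (hzero : s.vars zero = 0) (hinput : s.vars inputEnd = n * m) (hpos : s.vars pos = 0)
    (hL : queueBase n m < 2 ^ L) :
    Run D L powersCmd s (m * 5 + 3) fun s' =>
      s'.vars tableStart = n * m + m ∧ s'.vars power = 2 ^ m ∧
        (∀ k < m, s'.heap (n * m + k) = 2 ^ k) ∧
        ∀ a, a < n * m ∨ n * m + m ≤ a → s'.heap a = s.heap a := by
  have hm2 := Nat.two_pow_pos m
  rw [queueBase] at hL
  refine .step <| .const (by omega) <| .step <|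
    .add (c := n * m) (by simp +decide [hinput, hzero]) (by omega) ?_
  refine (Run.forLoop m (fun k u => u.vars pos = k ∧ u.vars tableStart = n * m + k ∧
    u.vars power = 2 ^ k ∧ (∀ l < k, u.heap (n * m + l) = 2 ^ l) ∧
    ∀ a, a < n * m ∨ n * m + k ≤ a → u.heap a = s.heap a) ?_ ?_ ?_).imp fun s' _ h => h.2
  · simp +decide [hpos]
  · rintro k u hu ⟨hk, -⟩
    rw [hk, hu.vars_eq wordLength]
    simp +decide [hm]
  · rintro k u hk hu ⟨hupos, htable, hpower, hpowers, hheap⟩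
    have huone : u.vars one = 1 := by simp +decide [hu.vars_eq one, hone]
    have hk2 : 2 ^ k + 2 ^ k ≤ 2 ^ m := by
      rw [← mul_two, ← pow_succ]
      exact Nat.pow_le_pow_right two_pos hk
    refine .step <| .store htable hpower <| .step <|
      .add (c := 2 ^ k + 2 ^ k) (by simp [hpower]) (by omega) <| .step <|
      .add (c := n * m + k + 1) (by simp +decide [htable, huone]) (by omega) <|
      .add (c := k + 1) (by simp +decide [hupos, huone]) (by omega) ?_
    refine ⟨by simp, by simp +decide [add_assoc], by simp +decide [pow_succ, mul_two],
      fun l hl => ?_, fun a ha => ?_⟩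
    · rcases (Nat.lt_succ_iff.1 hl).lt_or_eq with hlt | rfl
      · simp [hlt.ne, hpowers l hlt]
      · simp
    · simp (disch := omega) [if_neg, hheap]

theorem inputState_heap_of_lt (x : Fin n → BVec m) (ω : ℕ → Bool) (i : Fin n) {k : ℕ}
    (hk : k < m) : (inputState x ω).heap (i * m + k) = wordBit (x i) k := by
  have hi := mul_add_le_mul_of_fin i m
  have hlt : i * m + k < n * m := by omega
  have hindex : (⟨i * m + k, hlt⟩ : Fin (n * m)) = finProdFinEquiv (i, ⟨k, hk⟩) :=
    Fin.ext (by simp [mul_comm, add_comm])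
  simp only [inputState, dif_pos hlt, wordBit, dif_pos hk]
  rw [hindex, Equiv.symm_apply_apply]

theorem inputState_heap_of_le (x : Fin n → BVec m) (ω : ℕ → Bool) {a : ℕ} (h : n * m ≤ a) :
    (inputState x ω).heap a = 0 := by
  simp [inputState, h.not_gt]

theorem run_startCmd (x : Fin n → BVec m) (ω : ℕ → Bool)
    (hL : queueBase n m + n * n + n + 2 < 2 ^ L) :
    Run D L startCmd (inputState x ω) (n * 4 + m * 5 + 9) fun s' =>
      SearchState x [] s' ∧ s'.vars head = queueBase n m ∧ s'.vars src = 0 := by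
  have hqueue : queueBase n m = n * m + m + 2 ^ m := rfl
  have hm2 := Nat.two_pow_pos m
  have hinit (v : ℕ) (hv : 2 ≤ v) : (inputState x ω).vars v = 0 := by
    match v with
    | 0 | 1 => omega
    | v + 2 => rfl
  refine (Run.seq (run_constantsCmd (n := n) (m := m) rfl rfl (fun v hv => hinit v
    (by revert v; decide)) (by omega)) fun u hu ⟨hone, htwo, hinput, hpairs⟩ => ?_).le
      (by omega : n * 4 + 3 + (m * 5 + 3 + 3) ≤ _)
  have hzero : u.vars zero = 0 := hu.vars_eq zero
  have hm : u.vars wordLength = m := hu.vars_eq wordLength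
  refine Run.seq (run_powersCmd hm hone hzero hinput (hu.vars_eq pos) (by omega))
    fun w hw ⟨htable, hpower, hpowers, hheap⟩ => ?_
  replace hone := (hw.vars_eq one).trans hone
  replace hzero := (hw.vars_eq zero).trans hzero
  replace hm := (hw.vars_eq wordLength).trans hm
  refine .step <| .add (c := queueBase n m) (by rw [htable, hpower, hqueue]) (by omega) <| .step <|
    .add (c := queueBase n m) (by simp +decide [hzero]) (by omega) <|
    .add (c := m + 1) (by simp +decide [hm, hone]) (by omega) ?_
  have hempty (a : ℕ) (ha : n * m + m ≤ a) : w.heap a = 0 := by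
    rw [hheap a (.inr ha), hu.heap_eq, inputState_heap_of_le x ω (by omega)]
  have hready : Ready x w := ⟨(hw.vars_eq numVectors).trans (hu.vars_eq numVectors), hm, hone,
    hzero, (hw.vars_eq two).trans htwo, (hw.vars_eq inputEnd).trans hinput,
    (hw.vars_eq numPairs).trans hpairs, htable, fun i k hk => by
      have := mul_add_le_mul_of_fin i m
      rw [hheap _ (.inl (by omega)), hu.heap_eq, inputState_heap_of_lt x ω i hk], hpowers⟩
  have hlength : w.vars queueLength = 0 := by
    rw [hw.vars_eq queueLength, hu.vars_eq queueLength]; rfl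
  have hsrc : w.vars src = 0 := by rw [hw.vars_eq src, hu.vars_eq src]; rfl
  refine ⟨⟨hready.of_agree (by simp +decide [constantRegs]) fun _ _ => rfl,
    ⟨by simp +decide, by simp +decide [hlength], by simp⟩,
    ⟨fun z => ?_, .inl rfl, by simp [Covers]⟩⟩,
    by simp +decide, by simp +decide [hsrc]⟩
  simpa [tableEntry, firstSource] using hempty _ (by omega)

theorem run_digitCmd (h : Ready x s) {i : Fin n} (hsrc : s.vars src = i * m) {k : ℕ} (hk : k < m)
    (hpos : s.vars pos = k) (hcode : s.vars code = codeUpTo (x i) k)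
    (hL : queueBase n m < 2 ^ L) :
    Run D L digitCmd s 7 fun s' =>
      s'.vars pos = k + 1 ∧ s'.vars code = codeUpTo (x i) (k + 1) := by
  have hi := mul_add_le_mul_of_fin i m
  have hlt : codeUpTo (x i) (k + 1) < 2 ^ m :=
    (codeUpTo_lt (x i) (k + 1)).trans_le (Nat.pow_le_pow_right two_pos hk)
  have hbit := wordBit_lt_two (x i) k
  have hm2 := Nat.two_pow_pos m
  rw [queueBase] at hL
  rw [codeUpTo_succ] at hlt ⊢
  refine .step <| .add (c := i * m + k) (by rw [hsrc, hpos]) (by omega) <| .step <|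
    .load (c := wordBit (x i) k) (by simp +decide [h.input i k hk]) ?_
  refine .seq (N := 4) (N' := 1) (R := fun u => u.vars pos = k ∧ u.vars one = 1 ∧
    u.vars code = codeUpTo (x i) k + wordBit (x i) k * 2 ^ k) ?_ ?_
  · refine .ite (k := 0) (l := wordBit (x i) k) (by simp +decide [h.zero]) (by simp +decide)
      (fun hpos' => ?_) fun hle => .skip ?_
    · have hbit1 : wordBit (x i) k = 1 := by omega
      rw [hbit1, one_mul] at hlt ⊢
      refine .step <| .add (c := n * m + k) (by simp +decide [h.inputEnd, hpos]) (by omega) <|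
        .step <| .load (c := 2 ^ k) (by simp +decide [h.powers k hk]) <|
        .add (c := codeUpTo (x i) k + 2 ^ k) (by simp +decide [hcode]) (by omega) ?_
      simp +decide [hpos, h.one]
    · simp +decide [Nat.le_zero.1 hle, hpos, h.one, hcode]
  · rintro u - ⟨hupos, hone, hucode⟩
    exact .add (c := k + 1) (by rw [hupos, hone]) (by omega) (by simp +decide [hucode])

theorem run_codeCmd (h : Ready x s) {i : Fin n} (hsrc : s.vars src = i * m)
    (hL : queueBase n m < 2 ^ L) :
    Run D L codeCmd s (m * 8 + 3) fun s' => s'.vars code = wordCode (x i) := by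
  refine .step <| .const (by omega) <| .step <| .const (by omega) ?_
  set s₀ := (s.set code 0).set pos 0 with hs₀
  have h₀ : Ready x s₀ := h.of_agree (by simp +decide [hs₀, constantRegs]) fun _ _ => rfl
  refine (Run.forLoop m (fun k u => u.vars pos = k ∧ u.vars code = codeUpTo (x i) k)
    ⟨rfl, rfl⟩ ?_ ?_).imp fun s' _ h => h.2
  · rintro k u hu ⟨hk, -⟩
    rw [hk, (h₀.of_frame hu).wordLength]
  · rintro k u hk hu ⟨hpos, hcode⟩
    exact run_digitCmd (h₀.of_frame hu) ((hu.vars_eq src).trans hsrc) hk hpos hcode hL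

theorem run_sourceCmd (hm : 1 ≤ m) {P : List (Item n m)} (h : SearchState x P s) {i : Fin n}
    (hsrc : s.vars src = i * m) (hL : queueBase n m + 3 * (P.length + 1) + 2 < 2 ^ L) :
    Run D L sourceCmd s (m * 17 + 26) (SearchState x (P ++ [⟨x i, 0, i⟩])) := by
  refine (Run.seq (run_codeCmd h.toReady hsrc (by omega)) fun u hu hcode =>
    Run.seq (N := 1) (R := fun v => v.vars pos = 0) (.const (by omega) (by simp)) fun v hv hpos =>
      run_insertCmd (e := ⟨x i, 0, i⟩) hm ((h.of_frame hu).of_frame hv) ⟨?_, hpos, ?_⟩ hL).le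
        (by omega : m * 8 + 3 + (1 + (m * 9 + 22)) ≤ _)
  · exact (hv.vars_eq code).trans hcode
  · rw [hv.vars_eq src, hu.vars_eq src, hsrc]

theorem run_sourcesCmd (hm : 1 ≤ m) (h : SearchState x [] s) (hsrc : s.vars src = 0)
    (hL : queueBase n m + 3 * (n + 1) + 2 < 2 ^ L) :
    Run D L sourcesCmd s (n * (m * 17 + 28) + 1) (SearchState x (searchUpTo x 0)) := by
  set sources : List (Item n m) := (List.finRange n).map fun i => ⟨x i, 0, i⟩
  have hlen : sources.length = n := by simp [sources]
  have hqueue : queueBase n m = n * m + m + 2 ^ m := rfl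
  refine (Run.forLoop (N := m * 17 + 27) n (fun k u => u.vars src = k * m ∧
    SearchState x (sources.take k) u) ?_ ?_ ?_).imp ?_
  · exact ⟨by simp [hsrc], by simpa using h⟩
  · rintro k u - ⟨hk, hstate⟩
    rw [hk, hstate.inputEnd, Nat.mul_lt_mul_right hm]
  · rintro k u hk - ⟨husrc, hstate⟩
    have hkm : k * m + m ≤ n * m := mul_add_le_mul_of_fin ⟨k, hk⟩ m
    have hm2 := Nat.two_pow_pos m
    have hnext : sources.take (k + 1) = sources.take k ++ [⟨x ⟨k, hk⟩, 0, ⟨k, hk⟩⟩] := by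
      rw [List.take_succ_eq_append_getElem (by omega)]
      simp [sources]
    refine Run.seq (N' := 1) (run_sourceCmd (i := ⟨k, hk⟩) hm hstate husrc (by simp; omega))
      fun v hv hvstate => Run.imp (R := fun s' => s'.vars src = (k + 1) * m)
        (.add (c := k * m + m) ?_ (by omega) (by simp [Nat.succ_mul])) fun s' hs' hsrc' =>
          ⟨hsrc', hnext ▸ hvstate.of_frame hs'⟩
    rw [hv.vars_eq src, husrc, hvstate.wordLength]
  · rintro s' - ⟨-, hstate⟩
    rwa [List.take_of_length_le hlen.le] at hstate

end Preparation

section Output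

variable {n m : ℕ} {s : RAMState} {L : ℕ} {D : ℕ → BVec m → BVec m}

theorem run_divCmd (hm : 1 ≤ m) (hlength : s.vars wordLength = m) (hone : s.vars one = 1)
    {i : Fin n} (hsrc : s.vars src = i * m) (hL : n * m + m + 2 < 2 ^ L) :
    Run D L divCmd s (n * 3 + 3) fun s' => s'.vars quotient = i := by
  have hi := mul_add_le_mul_of_fin i m
  have hin := i.2
  refine .step <| .const (by omega) <| .step <| .const (by omega) ?_
  refine ((Run.forLoop (N := 2) i (fun k u => u.vars counter = k * m ∧ u.vars quotient = k)
    ?_ ?_ ?_).imp fun s' _ h => h.2).le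
      (by omega : (i : ℕ) * 3 + 1 ≤ _)
  · simp +decide
  · rintro k u hu ⟨hk, -⟩
    rw [hk, hu.vars_eq src]
    simp +decide [hsrc, Nat.mul_lt_mul_right hm]
  · rintro k u hk hu ⟨hcounter, hquotient⟩
    have hkm := Nat.mul_le_mul_right m hk
    have hk_le : k ≤ k * m := Nat.le_mul_of_pos_right k hm
    rw [Nat.succ_mul] at hkm
    have hum : u.vars wordLength = m := by simp +decide [hu.vars_eq wordLength, hlength]
    refine .step <| .add (c := k * m + m) (by rw [hcounter, hum]) (by omega) <|
      .add (c := k + 1) (by simp +decide [hquotient, hu.vars_eq one, hone]) (by omega) ?_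
    simp +decide [Nat.succ_mul]

theorem run_outputCmd (hm : 1 ≤ m) (hlength : s.vars wordLength = m) (hone : s.vars one = 1)
    (hzero : s.vars zero = 0) {i j : Fin n} (hi : s.vars bestLeft = i * m)
    (hj : s.vars bestRight = j * m) (hL : n * m + m + 2 < 2 ^ L) :
    Run D L outputCmd s (n * 6 + 10) fun s' =>
      s'.vars numVectors = i ∧ s'.vars wordLength = j := by
  have hi_le := mul_add_le_mul_of_fin i m
  have hj_le := mul_add_le_mul_of_fin j m
  have hin : (i : ℕ) ≤ i * m := Nat.le_mul_of_pos_right _ hm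
  have hjn : (j : ℕ) ≤ j * m := Nat.le_mul_of_pos_right _ hm
  refine .step <| .add (c := i * m) (by rw [hi, hzero, add_zero]) (by omega) ?_
  refine (Run.seq (run_divCmd hm (by simp +decide [hlength]) (by simp +decide [hone])
    (i := i) (by simp) hL) fun u hu hquotient => ?_).le
      (by omega : n * 3 + 3 + (n * 3 + 3 + 1 + 1 + 1) ≤ _)
  have huzero : u.vars zero = 0 := by simp +decide [hu.vars_eq zero, hzero]
  refine .step <| .add (c := i) (by rw [hquotient, huzero, add_zero]) (by omega) <| .step <|
    .add (c := j * m) (by simp +decide [hu.vars_eq bestRight, hj, huzero]) (by omega) ?_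
  refine Run.seq (N := n * 3 + 3) (N' := 1)
    (run_divCmd hm (by simp +decide [hu.vars_eq wordLength, hlength])
      (by simp +decide [hu.vars_eq one, hone]) (i := j) (by simp) hL) fun w hw hquotient' => ?_
  refine .add (c := j) (by simp +decide [hquotient', hw.vars_eq zero, huzero]) (by omega) ?_
  simp +decide [hw.vars_eq numVectors]

end Output

/-! ## The whole program -/

/-- Examine all pairs if the search has stopped before the diameter reached the best distance. -/
def completeCmd : Cmd := .ite diameter best allPairsCmd .skip

/-- Search in balls around the vectors, or among all pairs if these are fewer. -/
def closestPairCmd : Cmd := startCmd ;; sourcesCmd ;; searchCmd ;; completeCmd ;; outputCmd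

theorem queryFree_closestPairCmd : closestPairCmd.QueryFree := by
  simp [closestPairCmd, startCmd, constantsCmd, powersCmd, sourcesCmd, sourceCmd, codeCmd, digitCmd,
    insertCmd, enqueueCmd, recordCmd, collideCmd, examineCmd, measureCmd, compareBitsCmd, searchCmd,
    limitCmd, widenCmd, levelCmd, expandCmd, fetchCmd, childrenCmd, childCmd, flipCmd, completeCmd,
    allPairsCmd, rowCmd, outputCmd, divCmd, Cmd.QueryFree]

section ClosestPair

variable {n m : ℕ} {x : Fin n → BVec m} {i j : Fin n} {s : RAMState} {L ρ K : ℕ}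
  {D : ℕ → BVec m → BVec m}

theorem run_completeCmd (hm : 1 ≤ m) (hx : IsUniqueClosestPair x i j) (h : SearchInv x ρ s)
    (hlimit : s.vars limit ≤ 2 * ρ) (hρ : ρ ≤ K) (hL : n * m + m + 2 < 2 ^ L) :
    Run D L completeCmd s (n * min n (ballCard m K) * (m * 9 + 9) + n * 4 + 3) fun s' =>
      Attained x (s'.vars best) (s'.vars bestLeft) (s'.vars bestRight) ∧
        s'.vars best ≤ hammingDist (x i) (x j) := by
  refine .ite h.diameter rfl (fun hlt => ?_) fun hle => .skip ⟨h.state.attained, ?_⟩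
  · have hcount : n * n ≤ (searchUpTo x ρ).length := by
      by_contra hcount
      rw [h.limit, if_pos (not_le.1 hcount)] at hlimit
      omega
    rw [length_searchUpTo] at hcount
    have hn : n ≤ ballCard m K :=
      (Nat.le_of_mul_le_mul_left hcount i.pos).trans (ballCard_mono m hρ)
    rw [min_eq_left hn]
    exact ((run_allPairsCmd hm h.state.toReady h.state.attained hL).imp fun s' _ ⟨hatt, hall⟩ =>
      ⟨hatt, hall i j hx.1⟩).le (le_of_eq (by ring))
  · exact h.state.covers.le_hammingDist hx ((h.state.attained.hammingDist_le hx).trans hle)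

theorem closestPair_cost_le {M : ℕ} (hm : 1 ≤ m) (hn : 1 ≤ n) (hM : 1 ≤ M) (hK : K ≤ m) :
    n * 4 + m * 5 + 9 + (n * (m * 17 + 28) + 1 + (K * (n * M * (m * (m * 9 + 30) + 8) + 6) + 4 +
      (n * M * (m * 9 + 9) + n * 4 + 3 + (n * 6 + 10)))) ≤ n * M * (162 * m ^ 3) := by
  have hK' : K * (n * M * (m * (m * 9 + 30) + 8) + 6) ≤
      m * (n * M * (m * (m * 9 + 30) + 8) + 6) := Nat.mul_le_mul_right _ hK
  have hna : n ≤ n * M := Nat.le_mul_of_pos_right n hM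
  generalize n * M = a at *
  have hm1 : m ≤ m ^ 3 := Nat.le_self_pow (by norm_num) m
  have hm2 : m ^ 2 ≤ m ^ 3 := Nat.pow_le_pow_right hm (by norm_num)
  have ham1 : a * m ≤ a * m ^ 3 := Nat.mul_le_mul_left a hm1
  have ham2 : a * m ^ 2 ≤ a * m ^ 3 := Nat.mul_le_mul_left a hm2
  have ha : a ≤ a * m := Nat.le_mul_of_pos_right a hm
  have hnm : n * m ≤ a * m := Nat.mul_le_mul_right m hna
  have hma : m ≤ a * m := Nat.le_mul_of_pos_left m (by omega)
  linarith

theorem run_closestPairCmd (hm : 1 ≤ m) (hx : IsUniqueClosestPair x i j) (ω : ℕ → Bool)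
    (hL : queueBase n m + 3 * (n * 2 ^ m) + n * n + n + 2 < 2 ^ L)
    (hK : K = (hammingDist (x i) (x j) + 1) / 2) :
    Run D L closestPairCmd (inputState x ω) (n * min n (ballCard m K) * (162 * m ^ 3)) fun s' =>
      s'.vars numVectors = i ∧ s'.vars wordLength = j ∧
        s'.vars best = hammingDist (x i) (x j) := by
  have hqueue : queueBase n m = n * m + m + 2 ^ m := rfl
  have hdm : hammingDist (x i) (x j) ≤ m :=
    hammingDist_le_card_fintype.trans_eq (Fintype.card_fin m)
  have hball : 1 ≤ ballCard m K :=
    (by simp [ballCard] : 1 = ballCard m 0).trans_le (ballCard_mono m (Nat.zero_le K))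
  have hm2 : 2 ^ 1 ≤ 2 ^ m := Nat.pow_le_pow_right two_pos hm
  have hn : n + 1 ≤ n * 2 ^ m := by
    have := Nat.mul_le_mul_left n hm2
    have := i.pos
    omega
  refine Run.le ?_ (closestPair_cost_le (K := K) hm i.pos (le_min i.pos hball) (by omega))
  refine Run.seq (run_startCmd x ω (by omega)) fun s₁ _ ⟨h₁, hhead, hsrc⟩ => ?_
  refine Run.seq (run_sourcesCmd hm h₁ hsrc (by omega)) fun s₂ hs₂ h₂ => ?_
  refine Run.seq (run_searchCmd hm hx h₂ ((hs₂.vars_eq head).trans hhead) (by omega) hK)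
    fun s₃ _ ⟨ρ, hρ, h₃, hlimit⟩ => ?_
  refine Run.seq (run_completeCmd hm hx h₃ hlimit hρ (by omega)) fun s₄ hs₄ ⟨hatt, hle⟩ => ?_
  have h₄ : Ready x s₄ := h₃.state.toReady.of_frame hs₄
  obtain ⟨hleft, hright, hbest⟩ := hatt.eq_of_le hx hle
  exact (run_outputCmd hm h₄.wordLength h₄.one h₄.zero hleft hright (by omega)).imp
    fun s' hs' ⟨hi, hj⟩ => ⟨hi, hj, (hs'.vars_eq best).trans hbest⟩

theorem bounded_inputState (x : Fin n → BVec m) (ω : ℕ → Bool) (hL : n + m + 2 < 2 ^ L) :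
    (inputState x ω).Bounded L := by
  refine ⟨fun v => ?_, fun a => ?_⟩
  · simp only [inputState]
    split_ifs <;> omega
  · simp only [inputState]
    split_ifs with h
    · exact (ZMod.val_lt _).trans (by omega)
    · omega

theorem memory_lt_two_pow (hm : 1 ≤ m) :
    queueBase n m + 3 * (n * 2 ^ m) + n * n + n + 2 < 2 ^ (2 * (Nat.log 2 n + 1) + m + 4) := by
  have hnN : n ≤ 2 ^ (Nat.log 2 n + 1) := (Nat.lt_pow_succ_log_self one_lt_two n).le
  have hmq : m ≤ 2 ^ m := Nat.lt_two_pow_self.le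
  have hq : 2 ≤ 2 ^ m := Nat.pow_le_pow_right two_pos hm
  have hL : 2 ^ (2 * (Nat.log 2 n + 1) + m + 4) =
      2 ^ (Nat.log 2 n + 1) * 2 ^ (Nat.log 2 n + 1) * 2 ^ m * 16 := by ring
  have hN := Nat.two_pow_pos (Nat.log 2 n + 1)
  rw [hL, queueBase]
  generalize 2 ^ (Nat.log 2 n + 1) = N at *
  generalize 2 ^ m = q at *
  have hnNN : n ≤ N * N := hnN.trans (Nat.le_mul_of_pos_left N hN)
  have hnm : n * m ≤ N * N * q := Nat.mul_le_mul hnNN hmq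
  have hnq : n * q ≤ N * N * q := Nat.mul_le_mul_right q hnNN
  have hnn : n * n ≤ N * N * q :=
    (Nat.mul_le_mul hnN hnN).trans (Nat.le_mul_of_pos_right _ (by omega))
  have hNq : q ≤ N * N * q := Nat.le_mul_of_pos_left q (by positivity)
  have hnNq : n ≤ N * N * q := hnNN.trans (Nat.le_mul_of_pos_right _ (by omega))
  omega

end ClosestPair

/-- On input `x`, the program `p` with decoders `D` halts within time `T` with the correct output,
whatever the outcome of the coin tosses. -/
def SolvesWithin {n m : ℕ} (p : Cmd) (D : ℕ → BVec m → BVec m) (x : Fin n → BVec m) (i j : Fin n)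
    (T : ℝ) : Prop :=
  ∀ ω : ℕ → Bool, ∃ (s : RAMState) (t : ℕ), Exec D p (inputState x ω) s t ∧ (t : ℝ) ≤ T ∧
    s.vars 0 = i ∧ s.vars 1 = j ∧ s.vars 2 = hammingDist (x i) (x j)

section SolvesWithin

variable {n m : ℕ} {x : Fin n → BVec m} {i j : Fin n} {p : Cmd} {D : ℕ → BVec m → BVec m} {T T' : ℝ}

theorem SolvesWithin.mono (h : SolvesWithin p D x i j T) (hT : T ≤ T') :
    SolvesWithin p D x i j T' := fun ω =>
  let ⟨s, t, hexec, ht, hout⟩ := h ω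
  ⟨s, t, hexec, ht.trans hT, hout⟩

theorem SolvesWithin.finds (h : SolvesWithin p D x i j T) : Finds p D x i j T := by
  refine ⟨fun ω => ?_, ?_⟩
  · obtain ⟨s, t, hexec, ht, -⟩ := h ω
    exact ⟨s, t, hexec, ht⟩
  · have : IsProbabilityMeasure coinLaw := by
      unfold coinLaw
      infer_instance
    have huniv : {ω : ℕ → Bool | ∃ (s : RAMState) (t : ℕ), Exec D p (inputState x ω) s t ∧
        s.vars 0 = i ∧ s.vars 1 = j ∧ s.vars 2 = hammingDist (x i) (x j)} = Set.univ :=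
      Set.eq_univ_of_forall fun ω =>
        let ⟨s, t, hexec, _, hout⟩ := h ω
        ⟨s, t, hexec, hout⟩
    rw [huniv, probReal_univ]
    exact sub_le_self 1 (by positivity)

theorem solvesWithin_closestPairCmd_min (hm : 1 ≤ m) (hx : IsUniqueClosestPair x i j) :
    SolvesWithin closestPairCmd D x i j
      (n * (min n (ballCard m ((hammingDist (x i) (x j) + 1) / 2)) : ℕ) * (162 * m ^ 3) *
        (20 * (m * Nat.log 2 n))) := by
  intro ω
  have hlog : 1 ≤ Nat.log 2 n := Nat.log_pos one_lt_two (by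
    have := Fin.lt_def.1 hx.1
    omega)
  have hL := memory_lt_two_pow (n := n) hm
  have hn : n ≤ n * 2 ^ m := Nat.le_mul_of_pos_right n (Nat.two_pow_pos m)
  have hm2 : m < 2 ^ m := Nat.lt_two_pow_self
  obtain ⟨s, t, hexec, ht, -, hout⟩ := run_closestPairCmd (D := D) hm hx ω hL rfl
    (bounded_inputState x ω (by rw [queueBase] at hL; omega))
  refine ⟨s, t, hexec, ?_, hout⟩
  have hml : m ≤ m * Nat.log 2 n := Nat.le_mul_of_pos_right m hlog
  have hlm : Nat.log 2 n ≤ m * Nat.log 2 n := Nat.le_mul_of_pos_left _ hm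
  exact_mod_cast ht.trans (Nat.mul_le_mul_left _ (by omega))

theorem solvesWithin_closestPairCmd (hm : 1 ≤ m) (hx : IsUniqueClosestPair x i j) :
    SolvesWithin closestPairCmd D x i j
      (6480 * n * Real.logb 2 n * 2 ^ ((1 - kappaGV (hammingDist (x i) (x j) / m) -
        hammingDist (x i) (x j) / m) * m) * m ^ 6) := by
  set X : ℝ := 2 ^ ((1 - kappaGV (hammingDist (x i) (x j) / m) -
    hammingDist (x i) (x j) / m) * m)
  have hdm : hammingDist (x i) (x j) ≤ m :=
    hammingDist_le_card_fintype.trans_eq (Fintype.card_fin m)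
  have hmin : ((min n (ballCard m ((hammingDist (x i) (x j) + 1) / 2)) : ℕ) : ℝ) ≤
      2 * m ^ 2 * X := by
    rw [Nat.cast_min]
    exact min_card_ballCard_le hm hdm fun k l => hx.hammingDist_le
  have hlog : (Nat.log 2 n : ℝ) ≤ Real.logb 2 n := mod_cast Real.natLog_le_logb n 2
  refine (solvesWithin_closestPairCmd_min hm hx).mono ?_
  calc _ ≤ (n : ℝ) * (2 * m ^ 2 * X) * (162 * m ^ 3) * (20 * (m * Real.logb 2 n)) := by gcongr
    _ = 6480 * n * Real.logb 2 n * X * m ^ 6 := by ring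

end SolvesWithin

theorem mainTheorem4_general :
    (∃ (p : Cmd) (A : ℝ) (c : ℕ), 0 ≤ A ∧ p.QueryFree ∧
      ∀ (n m : ℕ) (D : ℕ → BVec m → BVec m) (x : Fin n → BVec m) (i j : Fin n),
        1 ≤ m → IsUniqueClosestPair x i j →
        SolvesWithin p D x i j
          (A * n * Real.logb 2 n * 2 ^ ((1 - kappaGV (hammingDist (x i) (x j) / m) -
            hammingDist (x i) (x j) / m) * m) * m ^ c)) ∧
    (∀ (n m : ℕ) (x : Fin n → BVec m) (i j : Fin n) (C : Finset (BVec m)) (r : ℕ)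
        (D : BVec m → BVec m),
      IsUniqueClosestPair x i j → Decodes C r D → hammingDist (x i) (x j) ≤ 2 * r →
      C.card * (hammingDist (x i) (x j)).choose r ≤
        {y : BVec m | IsGoodShift x i j D r y}.ncard) :=
  ⟨⟨closestPairCmd, 6480, 6, by norm_num, queryFree_closestPairCmd,
    fun _ _ _ _ _ _ hm hx => solvesWithin_closestPairCmd hm hx⟩,
    fun _ _ _ _ _ _ _ _ hx hD hle => hx.card_mul_choose_le_ncard_isGoodShift hD hle⟩

theorem mainTheorem4 :
    (∃ (A : ℝ) (c : ℕ), ∀ ε : ℝ, 0 < ε → ε ≤ 1 →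
      (∃ p : Cmd, p.QueryFree ∧
        ∀ (n m : ℕ) (x : Fin n → BVec m) (i j : Fin n),
          1 ≤ m → IsUniqueClosestPair x i j →
          Finds p (fun _ v => v) x i j
            (timeBound kappaZ A c ε n m (hammingDist (x i) (x j)))) ∧
      (∃ p : Cmd,
        ∀ (n m : ℕ) (C : ℕ → Finset (BVec m)) (D : ℕ → BVec m → BVec m)
          (x : Fin n → BVec m) (i j : Fin n),
          1 ≤ m → IsGVEnsemble ε m C D → IsUniqueClosestPair x i j →
          Finds p D x i j
            (timeBound kappaGV A c ε n m (hammingDist (x i) (x j))))) ∧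
    (∀ (n m : ℕ) (x : Fin n → BVec m) (i j : Fin n) (C : Finset (BVec m)) (d r : ℕ)
        (D : BVec m → BVec m),
      IsUniqueClosestPair x i j → HasMinDist C d → r = (d - 1) / 2 → Decodes C r D →
      hammingDist (x i) (x j) ≤ 2 * r → r ≤ hammingDist (x i) (x j) →
      C.card * (hammingDist (x i) (x j)).choose r ≤
        {y : BVec m | IsGoodShift x i j D r y}.ncard) := by
  obtain ⟨⟨p, A, c, hA, hp, hsolves⟩, hshifts⟩ := mainTheorem4_general
  refine ⟨⟨A, c, fun ε hε0 hε1 => ⟨⟨p, hp, fun n m x i j hm hx => ?_⟩,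
    p, fun n m C D x i j hm _ hx => ?_⟩⟩, fun n m x i j C d r D hx _ _ hD hle _ =>
      hshifts n m x i j C r D hx hD hle⟩
  · exact ((hsolves n m _ x i j hm hx).mono
      (le_timeBound (fun _ => kappaZ_le_kappaGV) hA hε0 hε1 c n m _)).finds
  · exact ((hsolves n m D x i j hm hx).mono
      (le_timeBound (fun _ _ => le_rfl) hA hε0 hε1 c n m _)).finds
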